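/- **Model.** Let $n,d\ge 1$, $K_n\in\{1,\dots,n\}$, $K_d\in\{1,\dots,d\}$ be integers and $\lambda\in[0,1]$. Let $S\subset[n]$ and $T\subset[d]$ be random sets such that all the events $\{i\in S\}$ ($i\in[n]$) and $\{k\in T\}$ ($k\in[d]$) are independent, with $\mathbb P(i\in S)=K_n/n$ and $\mathbb P(k\in T)=K_d/d$. Given $(S,T)$, the entries of $Y\in\{-1,1\}^{n\times d}$ are independent with $\mathbb E[Y_{ik}\mid S,T]=\lambda\mathbf 1\{i\in S,\ k\in T\}$. Write $\mathbb E$ for the expectation under the resulting (mixture) law. **Templates.** Consider finite bipartite graphs $G=(V,W,E)$, $E\subset V\times W$, with a distinguished node $v_1\in V$. Two of them are equivalent if there are bijections between the $V$'s and between the $W$'s that map $v_1$ to $v_1$ and preserve edges and non-edges; $\mathrm{Aut}^\star(G)$ is the group of such self-equivalences of $G$. For $D\ge 1$, let $\mathcal G^\star_{\le D}$ be a maximum collection of pairwise non-equivalent graphs $G$ with $1\le |E|\le D$ in which no node, except possibly $v_1$, is isolated. **Polynomials.** Let $G_1,\dots,G_m$ be the connected components of $G$ with at least one edge, with edge sets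 $E_1,\dots,E_m$. For injections $\sigma:V\to[n]$ with $\sigma(v_1)=1$ and $\tau:W\to[d]$ put $P_{G_l,\sigma,\tau}(Y)=\prod_{(v,w)\in E_l}Y_{\sigma(v),\tau(w)}$ and $$\overline P^\star_{G}=\sum_{\sigma,\tau}\ \prod_{l=1}^m\bigl(P_{G_l,\sigma,\tau}-\mathbb E[P_{G_l,\sigma,\tau}]\bigr),\qquad \Psi^\star_G=\frac{\overline P^\star_G}{\sqrt{\mathbb V^\star(G)}},\qquad \mathbb V^\star(G)=\frac{(n-1)!}{(n-|V|)!}\,\frac{d!}{(d-|W|)!}\,|\mathrm{Aut}^\star(G)|,$$ where the sum is over all such pairs $(\sigma,\tau)$. **Theorem.** There is a universal constant $c_0>0$ such that the following holds for every real $c_s\ge c_0$. Let $n,d,K_n,K_d,\lambda$ be as above, let $D\ge 2$ be an integer, and assume $$\frac{K_n}{n}\vee\frac{K_d}{d}\vee\frac{\lambda K_n}{\sqrt n}\vee\frac{\lambda K_d}{\sqrt d}\vee\lambda\ \le\ D^{-8c_s}.$$ Then, for all real coefficients $\alpha_\emptyset$ and $(\alpha_G)_{G\in\mathcal G^\star_{\le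 D}}$, $$(1-D^{-c_s/4})\Bigl[\alpha_\emptyset^2+\sum_{G\in\mathcal G^\star_{\le D}}\alpha_G^2\Bigr]\le \mathbb E\Bigl[\Bigl(\alpha_\emptyset+\sum_{G\in\mathcal G^\star_{\le D}}\alpha_G\Psi^\star_G\Bigr)^2\Bigr]\le (1+D^{-c_s/4})\Bigl[\alpha_\emptyset^2+\sum_{G\in\mathcal G^\star_{\le D}}\alpha_G^2\Bigr].$$ (The hypotheses force $n\ge |V|$ and $d\ge |W|$ for every template, after enlarging $c_0$, so that $\mathbb V^\star(G)$ is well defined.) -/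

import Mathlib

open MeasureTheory

noncomputable section

namespace SubmatrixLD

/-! ### The observation model -/

/-- The law of a `{-1, 1}`-valued variable with mean `m ∈ [-1, 1]`. -/
def signLaw (m : ℝ) : Measure ℝ :=
  ENNReal.ofReal ((1 + m) / 2) • Measure.dirac 1 +
    ENNReal.ofReal ((1 - m) / 2) • Measure.dirac (-1)

/-- The block matrix `lam * 1{S × T}`. -/
def blockMatrix {n d : ℕ} (lam : ℝ) (S : Finset (Fin n)) (T : Finset (Fin d)) :
    Fin n × Fin d → ℝ :=
  fun e => if e.1 ∈ S ∧ e.2 ∈ T then lam else 0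

/-- The law of an `n × d` array of independent signs whose matrix of means is `M`. -/
def condLaw {n d : ℕ} (M : Fin n × Fin d → ℝ) : Measure (Fin n × Fin d → ℝ) :=
  Measure.pi fun e => signLaw (M e)

/-- The probability that a random subset of `Fin m`, containing each point independently with
probability `p`, equals `S`. -/
def bernoulliWeight {m : ℕ} (p : ℝ) (S : Finset (Fin m)) : ℝ :=
  ∏ i, if i ∈ S then p else 1 - p

/-- The mixture law of the observation `Y`: the events `i ∈ S` (probability `Kn / n`) and `k ∈ T`
(probability `Kd / d`) are independent and, given `(S, T)`, the entries of `Y` are independent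
signs with means `lam * 1{i ∈ S, k ∈ T}`. -/
def mixtureLaw (n d Kn Kd : ℕ) (lam : ℝ) : Measure (Fin n × Fin d → ℝ) :=
  ∑ S : Finset (Fin n), ∑ T : Finset (Fin d),
    ENNReal.ofReal (bernoulliWeight ((Kn : ℝ) / n) S * bernoulliWeight ((Kd : ℝ) / d) T) •
      condLaw (blockMatrix lam S T)

/-! ### Rooted bipartite graphs -/

/-- A bipartite graph `(V, W, E)` with `V` nonempty; the distinguished node `v₁` is `0`. -/
structure BiGraph where
  /-- number of nodes of `V` other than `v₁` -/
  r : ℕ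
  /-- number of nodes of `W` -/
  s : ℕ
  /-- the edge set -/
  E : Finset (Fin (r + 1) × Fin s)

namespace BiGraph

/-- At least one edge, at most `D` edges, and no isolated node except possibly `v₁`. -/
def IsTemplate (D : ℕ) (G : BiGraph) : Prop :=
  1 ≤ G.E.card ∧ G.E.card ≤ D ∧
    (∀ v : Fin (G.r + 1), v ≠ 0 → ∃ w, (v, w) ∈ G.E) ∧
    (∀ w : Fin G.s, ∃ v, (v, w) ∈ G.E)

/-- Isomorphism of bipartite graphs respecting the distinguished nodes. -/
def Equivalent (G H : BiGraph) : Prop :=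
  ∃ (f : Fin (G.r + 1) ≃ Fin (H.r + 1)) (g : Fin G.s ≃ Fin H.s),
    f 0 = 0 ∧ ∀ v w, (v, w) ∈ G.E ↔ (f v, g w) ∈ H.E

/-- A maximum collection of pairwise non-equivalent templates with at most `D` edges. -/
def IsTemplateCollection (D : ℕ) (𝒢 : Finset BiGraph) : Prop :=
  (∀ G ∈ 𝒢, G.IsTemplate D) ∧
    (∀ G ∈ 𝒢, ∀ H ∈ 𝒢, G.Equivalent H → G = H) ∧
    ∀ G : BiGraph, G.IsTemplate D → ∃ H ∈ 𝒢, G.Equivalent H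

/-- The number of automorphisms of `G` that fix `v₁`. -/
def autCard (G : BiGraph) : ℕ :=
  Nat.card {f : Equiv.Perm (Fin (G.r + 1)) × Equiv.Perm (Fin G.s) //
    f.1 0 = 0 ∧ ∀ v w, (v, w) ∈ G.E ↔ (f.1 v, f.2 w) ∈ G.E}

/-- The underlying simple graph on the node set `V ⊔ W`. -/
def toSimpleGraph (G : BiGraph) : SimpleGraph (Fin (G.r + 1) ⊕ Fin G.s) :=
  SimpleGraph.fromRel fun x y => ∃ v w, x = Sum.inl v ∧ y = Sum.inr w ∧ (v, w) ∈ G.E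

/-- The connected component that contains the edge `e`. -/
def edgeComponent (G : BiGraph) (e : Fin (G.r + 1) × Fin G.s) :
    G.toSimpleGraph.ConnectedComponent :=
  G.toSimpleGraph.connectedComponentMk (Sum.inl e.1)

open Classical in
/-- The connected components of `G` with at least one edge. -/
def components (G : BiGraph) : Finset G.toSimpleGraph.ConnectedComponent :=
  G.E.image G.edgeComponent

open Classical in
/-- The edges of the connected component `c`. -/
def componentEdges (G : BiGraph) (c : G.toSimpleGraph.ConnectedComponent) :
    Finset (Fin (G.r + 1) × Fin G.s) :=
  G.E.filter fun e => G.edgeComponent e = c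

/-! ### The polynomials -/

/-- The monomial `∏ Y_{σ(v), τ(w)}` over the edges `(v, w)` of the component `c`. -/
def componentMonomial (G : BiGraph) {n d : ℕ} (c : G.toSimpleGraph.ConnectedComponent)
    (σ : Fin (G.r + 1) ↪ Fin n) (τ : Fin G.s ↪ Fin d) (Y : Fin n × Fin d → ℝ) : ℝ :=
  ∏ e ∈ G.componentEdges c, Y (σ e.1, τ e.2)

/-- The product over the connected components of the monomials, each centred under the mixture
law. -/
def labelledPoly (G : BiGraph) {n d : ℕ} (Kn Kd : ℕ) (lam : ℝ)
    (σ : Fin (G.r + 1) ↪ Fin n) (τ : Fin G.s ↪ Fin d) (Y : Fin n × Fin d → ℝ) : ℝ :=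
  ∏ c ∈ G.components, (G.componentMonomial c σ τ Y -
    ∫ Z, G.componentMonomial c σ τ Z ∂(mixtureLaw n d Kn Kd lam))

/-- The sum of the labelled polynomials over all pairs of injective labellings such that `v₁` is
sent to the first row. -/
def templatePoly (G : BiGraph) {n d : ℕ} [NeZero n] (Kn Kd : ℕ) (lam : ℝ)
    (Y : Fin n × Fin d → ℝ) : ℝ :=
  ∑ σ : Fin (G.r + 1) ↪ Fin n with σ 0 = 0, ∑ τ : Fin G.s ↪ Fin d,
    G.labelledPoly Kn Kd lam σ τ Y

/-- The normalisation `(n-1)! / (n-|V|)! * d! / (d-|W|)! * |Aut*(G)|`. -/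
def normalization (G : BiGraph) (n d : ℕ) : ℝ :=
  ((n - 1).factorial : ℝ) / ((n - (G.r + 1)).factorial : ℝ) *
    ((d.factorial : ℝ) / ((d - G.s).factorial : ℝ)) * (G.autCard : ℝ)

/-- The normalised, centred template polynomial `Ψ*_G`. -/
def Psi (G : BiGraph) {n d : ℕ} [NeZero n] (Kn Kd : ℕ) (lam : ℝ)
    (Y : Fin n × Fin d → ℝ) : ℝ :=
  G.templatePoly Kn Kd lam Y / Real.sqrt (G.normalization n d)

end BiGraph

end SubmatrixLD

end

/-!
The polynomial of a labelled template depends only on the edge set `A` of the copy: it is the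
product `P_A` of the centred monomials of the components of `A`. A template is determined up to
equivalence by any of its copies, and each copy comes from exactly `|Aut*|` labellings, so a linear
combination of the `Ψ*_G` is a sum `∑ c_A P_A` whose coefficients have the same square norm. It
remains to see that the `P_A` are nearly orthonormal.

The mean of `P_A P_B` vanishes unless every component of `A` meets `B` and conversely, and it is
always at most `16 ^ |A ∆ B|` times the moment of `A ∆ B`. When the components do meet, every
nonempty set `X` of nodes in `V(A) ∆ V(B)` is left by an edge of `A ∆ B`, since otherwise `X` would
contain a whole component of one edge set that avoids the other. Hence `|V(A) ∆ V(B)| ≤ |A ∆ B|`,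
and each node of the symmetric difference can be paid for with one factor `lam`. In the Schur test
with weight `n ^ (-1/2)` per row and `d ^ (-1/2)` per column, the rows of the Gram matrix minus the
identity are then bounded by a geometric series in a multiple of `D² ε`, where `ε = D ^ (-8 c_s)`.
-/

noncomputable section

namespace SubmatrixLD

section EdgeSets

/-! ### Edge sets and their components -/

lemma card_le_card_of_forall_exists_leaving {α V : Type*} [DecidableEq V]
    (ends : α → Finset V) (F : Finset α) (X : Finset V)
    (hX : ∀ X' ⊆ X, X'.Nonempty → ∃ e ∈ F, (ends e ∩ X').card = 1) : X.card ≤ F.card := by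
  classical
  induction F using Finset.strongInduction generalizing X with
  | H F ih =>
    rcases X.eq_empty_or_nonempty with rfl | hne
    · simp
    obtain ⟨e, he, hcard⟩ := hX X subset_rfl hne
    obtain ⟨v, hv⟩ := Finset.card_eq_one.1 hcard
    have hvX : v ∈ X := Finset.mem_of_mem_inter_right (hv ▸ Finset.mem_singleton_self v)
    have hrec : (X.erase v).card ≤ (F.erase e).card := by
      refine ih _ (Finset.erase_ssubset he) _ fun X' hX' hne' => ?_
      obtain ⟨f, hf, hf1⟩ := hX X' (hX'.trans (Finset.erase_subset v X)) hne'
      refine ⟨f, Finset.mem_erase.2 ⟨?_, hf⟩, hf1⟩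
      rintro rfl
      have hsub : ends f ∩ X' ⊆ {v} :=
        hv ▸ Finset.inter_subset_inter_left (hX'.trans (Finset.erase_subset v X))
      obtain ⟨w, hw⟩ := Finset.card_pos.1 (hf1 ▸ one_pos)
      exact Finset.notMem_erase v X
        (hX' (Finset.mem_singleton.1 (hsub hw) ▸ Finset.mem_of_mem_inter_right hw))
    rw [Finset.card_erase_of_mem hvX, Finset.card_erase_of_mem he] at hrec
    have := Finset.card_pos.2 ⟨e, he⟩
    omega

variable {ι κ : Type*}

/-- Two cells `(i, k)` of an array, seen as edges between the row `i` and the column `k`, touch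
when they have a row or a column in common. -/
def Touch (e f : ι × κ) : Prop := e.1 = f.1 ∨ e.2 = f.2

lemma touch_map_iff {ι' κ' : Type*} {σ : ι → ι'} {τ : κ → κ'} (hσ : σ.Injective)
    (hτ : τ.Injective) {e f : ι × κ} :
    Touch (Prod.map σ τ e) (Prod.map σ τ f) ↔ Touch e f := by
  simp only [Touch, Prod.map_fst, Prod.map_snd, hσ.eq_iff, hτ.eq_iff]

variable [DecidableEq ι] [DecidableEq κ]

/-- The two nodes of an edge. The nodes are the rows and the columns of the array. -/
def endpoints (e : ι × κ) : Finset (ι ⊕ κ) := {Sum.inl e.1, Sum.inr e.2}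

/-- The nodes met by an edge set. -/
def verts (A : Finset (ι × κ)) : Finset (ι ⊕ κ) := A.biUnion endpoints

variable {A B C : Finset (ι × κ)} {e f : ι × κ}

lemma inl_mem_verts {i : ι} : Sum.inl i ∈ verts A ↔ ∃ k, (i, k) ∈ A := by
  simp [verts, endpoints]

lemma inr_mem_verts {k : κ} : Sum.inr k ∈ verts A ↔ ∃ i, (i, k) ∈ A := by
  simp [verts, endpoints]

lemma card_endpoints (e : ι × κ) : (endpoints e).card = 2 :=
  Finset.card_pair Sum.inl_ne_inr

lemma endpoints_subset_verts (he : e ∈ A) : endpoints e ⊆ verts A :=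
  Finset.subset_biUnion_of_mem endpoints he

lemma verts_mono (hAB : A ⊆ B) : verts A ⊆ verts B :=
  Finset.biUnion_subset_biUnion_of_subset_left endpoints hAB

lemma verts_union (A B : Finset (ι × κ)) : verts (A ∪ B) = verts A ∪ verts B :=
  Finset.union_biUnion

lemma verts_insert (e : ι × κ) (A : Finset (ι × κ)) :
    verts (insert e A) = endpoints e ∪ verts A :=
  Finset.biUnion_insert

lemma card_verts_le (A : Finset (ι × κ)) : (verts A).card ≤ A.card * 2 :=
  Finset.card_biUnion_le_card_mul A endpoints 2 fun e _ => (card_endpoints e).le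

lemma disjoint_of_disjoint_verts (h : Disjoint (verts A) (verts B)) : Disjoint A B := by
  refine Finset.disjoint_left.2 fun e heA heB => ?_
  have hmem : Sum.inl e.1 ∈ endpoints e := by simp [endpoints]
  exact Finset.disjoint_left.1 h (endpoints_subset_verts heA hmem) (endpoints_subset_verts heB hmem)

lemma touch_iff_not_disjoint : Touch e f ↔ ¬Disjoint (endpoints e) (endpoints f) := by
  simp [Touch, endpoints, or_iff_not_imp_left, eq_comm]

lemma disjoint_verts_iff : Disjoint (verts A) (verts B) ↔ ∀ e ∈ A, ∀ f ∈ B, ¬Touch e f := by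
  simp only [verts, Finset.disjoint_biUnion_left, Finset.disjoint_biUnion_right,
    touch_iff_not_disjoint, not_not]
  exact forall₂_comm

lemma verts_symmDiff_sdiff_verts (A B : Finset (ι × κ)) :
    verts (symmDiff A B) \ verts A = verts B \ verts A := by
  have hunion : verts (symmDiff A B) ∪ verts A = verts B ∪ verts A := by
    rw [← verts_union, ← verts_union]
    congr 1
    ext e
    simp only [Finset.mem_union, Finset.mem_symmDiff]
    tauto
  rw [← Finset.union_sdiff_right, hunion, Finset.union_sdiff_right]

lemma symmDiff_verts_subset (A B : Finset (ι × κ)) :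
    symmDiff (verts A) (verts B) ⊆ verts (symmDiff A B) := by
  intro v hv
  rcases Finset.mem_symmDiff.1 hv with h | h
  · have := verts_symmDiff_sdiff_verts B A ▸ Finset.mem_sdiff.2 h
    exact symmDiff_comm A B ▸ Finset.sdiff_subset this
  · have := verts_symmDiff_sdiff_verts A B ▸ Finset.mem_sdiff.2 h
    exact Finset.sdiff_subset this

open Classical in
/-- The partition of the edge set `A` into the edge sets of its connected components. -/
def connectedParts (A : Finset (ι × κ)) : Finpartition A :=
  Finpartition.ofSetSetoid
    (Relation.EqvGen.setoid fun e f => e ∈ A ∧ f ∈ A ∧ Touch e f) A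

lemma mem_of_touch (hC : C ∈ (connectedParts A).parts) (he : e ∈ C) (hf : f ∈ A)
    (hef : Touch e f) : f ∈ C := by
  classical
  have heA : e ∈ A := (connectedParts A).le hC he
  rw [← (connectedParts A).part_eq_of_mem hC he]
  exact (Finpartition.mem_part_ofSetSetoid_iff_rel A).2 ⟨heA, hf, .rel e f ⟨heA, hf, hef⟩⟩

lemma subset_of_closed_under_touch (hC : C ∈ (connectedParts A).parts) {U : Set (ι × κ)}
    (hU : ∀ e ∈ U, e ∈ A → ∀ f ∈ A, Touch e f → f ∈ U) (he : e ∈ C) (heU : e ∈ U) :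
    (C : Set (ι × κ)) ⊆ U := by
  classical
  intro f hf
  rw [Finset.mem_coe, ← (connectedParts A).part_eq_of_mem hC he] at hf
  have hrel := ((Finpartition.mem_part_ofSetSetoid_iff_rel A).1 hf).2.2
  refine Iff.mp ?_ heU
  clear he heU hf
  induction hrel with
  | rel x y h =>
    exact ⟨fun hx => hU x hx h.1 y h.2.1 h.2.2,
      fun hy => hU y hy h.2.1 x h.1 (h.2.2.imp Eq.symm Eq.symm)⟩
  | refl x => rfl
  | symm x y _ ih => exact ih.symm
  | trans x y z _ _ ihxy ihyz => exact ihxy.trans ihyz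

lemma pairwiseDisjoint_verts (A : Finset (ι × κ)) :
    ((connectedParts A).parts : Set (Finset (ι × κ))).PairwiseDisjoint verts :=
  fun _ hC _ hC' hne => disjoint_verts_iff.2 fun _ he _ hf hef =>
    hne <| (connectedParts A).eq_of_mem_parts hC hC'
      (mem_of_touch hC he ((connectedParts A).le hC' hf) hef) hf

lemma mem_connectedParts_of_minimal (hCA : C ⊆ A) (he : e ∈ C)
    (hclosed : ∀ x ∈ C, ∀ y ∈ A, Touch x y → y ∈ C)
    (hmin : ∀ U : Set (ι × κ), (∀ x ∈ U, x ∈ A → ∀ y ∈ A, Touch x y → y ∈ U) → e ∈ U →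
      (C : Set (ι × κ)) ⊆ U) : C ∈ (connectedParts A).parts := by
  have hpart := (connectedParts A).part_mem.2 (hCA he)
  have hself := (connectedParts A).mem_part_self.2 (hCA he)
  convert hpart
  exact Finset.Subset.antisymm
    (Finset.coe_subset.1 <| hmin _ (fun x hx _ y hy => mem_of_touch hpart hx hy) hself)
    (Finset.coe_subset.1 <|
      subset_of_closed_under_touch hpart (fun x hx _ y hy => hclosed x hx y hy) hself he)

lemma mem_connectedParts_of_disjoint (hC : C ∈ (connectedParts A).parts) (hCB : C ⊆ B)
    (hdisj : Disjoint (verts C) (verts (B \ A))) : C ∈ (connectedParts B).parts := by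
  obtain ⟨e, he⟩ := (connectedParts A).nonempty_of_mem_parts hC
  refine mem_connectedParts_of_minimal hCB he (fun x hx y hy hxy => ?_) fun U hU heU => ?_
  · by_cases hyA : y ∈ A
    · exact mem_of_touch hC hx hyA hxy
    · exact absurd hxy (disjoint_verts_iff.1 hdisj x hx y (Finset.mem_sdiff.2 ⟨hy, hyA⟩))
  · have hinter : (C : Set (ι × κ)) ⊆ C ∩ U :=
      subset_of_closed_under_touch hC (fun x hx _ y hy hxy =>
        have hyC := mem_of_touch hC hx.1 hy hxy
        ⟨hyC, hU x hx.2 (hCB hx.1) y (hCB hyC) hxy⟩) he ⟨he, heU⟩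
    exact hinter.trans Set.inter_subset_right

lemma card_connectedParts_sdiff_le (A B : Finset (ι × κ)) :
    ((connectedParts A).parts \ (connectedParts B).parts).card ≤ (symmDiff A B).card * 2 := by
  refine (Finset.card_le_card_of_forall_subsingleton (fun C v => v ∈ verts C) ?_ ?_).trans
    (card_verts_le (symmDiff A B))
  · intro C hC
    obtain ⟨hCA, hCB⟩ := Finset.mem_sdiff.1 hC
    contrapose! hCB
    have hdisj : Disjoint (verts C) (verts (symmDiff A B)) :=
      Finset.disjoint_left.2 fun v hvC hv => hCB v hv hvC
    refine mem_connectedParts_of_disjoint hCA (fun e he => ?_)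
      (hdisj.mono_right (verts_mono (le_sup_right : B \ A ≤ symmDiff A B)))
    by_contra heB
    exact Finset.disjoint_left.1 (disjoint_of_disjoint_verts hdisj) he
      (Finset.mem_symmDiff.2 (Or.inl ⟨(connectedParts A).le hCA he, heB⟩))
  · rintro v - C ⟨hC, hvC⟩ C' ⟨hC', hvC'⟩
    by_contra hne
    exact Finset.disjoint_left.1 (pairwiseDisjoint_verts A
      (Finset.mem_sdiff.1 hC).1 (Finset.mem_sdiff.1 hC').1 hne) hvC hvC'

/-- Every connected component of `A` shares a node with `B`. -/
def EachPartMeets (A B : Finset (ι × κ)) : Prop :=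
  ∀ C ∈ (connectedParts A).parts, ¬Disjoint (verts C) (verts B)

lemma EachPartMeets.exists_leaving (hAB : EachPartMeets A B) {X : Finset (ι ⊕ κ)}
    (hX : X ⊆ symmDiff (verts A) (verts B)) {v : ι ⊕ κ} (hvX : v ∈ X) (hvA : v ∈ verts A) :
    ∃ e ∈ symmDiff A B, (endpoints e ∩ X).card = 1 := by
  by_contra! hno
  have hsub : ∀ e ∈ A, ∀ v ∈ X, v ∈ endpoints e → endpoints e ⊆ X := fun e he v hvX hve => by
    have hmem : v ∈ endpoints e ∩ X := Finset.mem_inter.2 ⟨hve, hvX⟩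
    have heB : e ∉ B := fun heB => by
      have := Finset.mem_symmDiff.1 (hX hvX)
      have := endpoints_subset_verts he hve
      have := endpoints_subset_verts heB hve
      tauto
    have hne1 := hno e (Finset.mem_symmDiff.2 (Or.inl ⟨he, heB⟩))
    have hle := Finset.card_le_card (Finset.inter_subset_left (s₁ := endpoints e) (s₂ := X))
    have hpos := Finset.card_pos.2 ⟨v, hmem⟩
    rw [card_endpoints] at hle
    exact Finset.inter_eq_left.1
      (Finset.eq_of_subset_of_card_le Finset.inter_subset_left (by rw [card_endpoints]; omega))
  obtain ⟨e, he, hve⟩ := Finset.mem_biUnion.1 hvA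
  have hpart := (connectedParts A).part_mem.2 he
  have hpartX : ((connectedParts A).part e : Set (ι × κ)) ⊆ {f | endpoints f ⊆ X} := by
    refine subset_of_closed_under_touch hpart (fun x hx _ y hy hxy => ?_)
      ((connectedParts A).mem_part_self.2 he) (hsub e he v hvX hve)
    obtain ⟨w, hwx, hwy⟩ := Finset.not_disjoint_iff.1 (touch_iff_not_disjoint.1 hxy)
    exact hsub y hy w (hx hwx) hwy
  refine hAB _ hpart (Finset.disjoint_left.2 fun w hw hwB => ?_)
  obtain ⟨f, hf, hwf⟩ := Finset.mem_biUnion.1 hw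
  have hwA := endpoints_subset_verts ((connectedParts A).part_subset e hf) hwf
  have := Finset.mem_symmDiff.1 (hX (hpartX hf hwf))
  tauto

lemma EachPartMeets.card_symmDiff_verts_le (hAB : EachPartMeets A B) (hBA : EachPartMeets B A) :
    (symmDiff (verts A) (verts B)).card ≤ (symmDiff A B).card := by
  refine card_le_card_of_forall_exists_leaving endpoints _ _ fun X hX hne => ?_
  obtain ⟨v, hv⟩ := hne
  rcases Finset.mem_symmDiff.1 (hX hv) with ⟨hvA, -⟩ | ⟨hvB, -⟩
  · exact hAB.exists_leaving hX hv hvA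
  · rw [symmDiff_comm] at hX ⊢
    exact hBA.exists_leaving hX hv hvB

lemma image_mem_connectedParts {ι' κ' : Type*} [DecidableEq ι'] [DecidableEq κ']
    {σ : ι → ι'} {τ : κ → κ'} (hσ : σ.Injective) (hτ : τ.Injective)
    (hC : C ∈ (connectedParts A).parts) :
    C.image (Prod.map σ τ) ∈ (connectedParts (A.image (Prod.map σ τ))).parts := by
  obtain ⟨e, he⟩ := (connectedParts A).nonempty_of_mem_parts hC
  refine mem_connectedParts_of_minimal (Finset.image_subset_image ((connectedParts A).le hC))
    (Finset.mem_image_of_mem _ he) ?_ fun U hU heU => ?_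
  · simp only [Finset.forall_mem_image]
    exact fun x hx y hy hxy => Finset.mem_image_of_mem _
      (mem_of_touch hC hx hy ((touch_map_iff hσ hτ).1 hxy))
  · rw [Finset.coe_image, Set.image_subset_iff]
    exact subset_of_closed_under_touch hC (fun x hx hxA y hy hxy =>
      hU _ hx (Finset.mem_image_of_mem _ hxA) _ (Finset.mem_image_of_mem _ hy)
        ((touch_map_iff hσ hτ).2 hxy)) he heU

end EdgeSets

section Moments

/-! ### Moments of the observation -/

variable {ι κ : Type*}

/-- The monomial `∏ Y_e` over the edges of `F`. -/
def mono (F : Finset (ι × κ)) (Y : ι × κ → ℝ) : ℝ := ∏ e ∈ F, Y e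

lemma mono_empty (Y : ι × κ → ℝ) : mono ∅ Y = 1 := rfl

variable [DecidableEq ι] [DecidableEq κ] {F G : Finset (ι × κ)}

lemma mono_mul_mono_of_mul_self_eq_one {Y : ι × κ → ℝ} (hY : ∀ e, Y e * Y e = 1)
    (F G : Finset (ι × κ)) : mono F Y * mono G Y = mono (symmDiff F G) Y := by
  have hunion : mono (F ∪ G) Y = mono (symmDiff F G) Y * mono (F ∩ G) Y := by
    rw [mono, ← Finset.sup_eq_union, ← symmDiff_sup_inf,
      Finset.sup_eq_union, Finset.prod_union (disjoint_symmDiff_inf F G)]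
    rfl
  have hsq : mono (F ∩ G) Y * mono (F ∩ G) Y = 1 := by
    rw [mono, ← Finset.prod_mul_distrib]
    exact Finset.prod_eq_one fun e _ => hY e
  calc mono F Y * mono G Y = mono (F ∪ G) Y * mono (F ∩ G) Y :=
        Finset.prod_union_inter.symm
    _ = mono (symmDiff F G) Y := by rw [hunion, mul_assoc, hsq, mul_one]

/-- The moment `lam ^ |F| * ∏ x_v` over the nodes met by `F`: the mean of `mono F` when every
node `v` is independently selected with probability `x v`, and edges between selected nodes carry
independent signs of mean `lam`. -/
def moment (lam : ℝ) (x : ι ⊕ κ → ℝ) (F : Finset (ι × κ)) : ℝ :=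
  lam ^ F.card * ∏ v ∈ verts F, x v

lemma moment_union_of_disjoint (lam : ℝ) (x : ι ⊕ κ → ℝ) (h : Disjoint (verts F) (verts G)) :
    moment lam x (F ∪ G) = moment lam x F * moment lam x G := by
  rw [moment, verts_union, Finset.card_union_of_disjoint (disjoint_of_disjoint_verts h),
    Finset.prod_union h, pow_add, mul_mul_mul_comm]
  rfl

section Bounds

variable {lam : ℝ} {x : ι ⊕ κ → ℝ} (hlam : lam ∈ Set.Icc (0 : ℝ) 1)
  (hx : ∀ v, x v ∈ Set.Icc (0 : ℝ) 1)
include hlam hx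

lemma moment_nonneg (F : Finset (ι × κ)) : 0 ≤ moment lam x F :=
  mul_nonneg (pow_nonneg hlam.1 _) (Finset.prod_nonneg fun v _ => (hx v).1)

lemma moment_anti (hFG : F ⊆ G) : moment lam x G ≤ moment lam x F :=
  mul_le_mul (pow_le_pow_of_le_one hlam.1 hlam.2 (Finset.card_le_card hFG))
    (Finset.prod_le_prod_of_subset_of_le_one (verts_mono hFG) (fun v _ => (hx v).1)
      fun v _ _ => (hx v).2)
    (Finset.prod_nonneg fun v _ => (hx v).1) (pow_nonneg hlam.1 _)

lemma moment_mul_moment_le (F G : Finset (ι × κ)) :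
    moment lam x F * moment lam x G ≤ moment lam x (F ∪ G) := by
  have hinter : ∏ v ∈ verts F ∩ verts G, x v ≤ 1 :=
    Finset.prod_le_one (fun v _ => (hx v).1) fun v _ => (hx v).2
  have hunion : 0 ≤ ∏ v ∈ verts F ∪ verts G, x v := Finset.prod_nonneg fun v _ => (hx v).1
  calc moment lam x F * moment lam x G
      = lam ^ (F.card + G.card) *
          ((∏ v ∈ verts F ∪ verts G, x v) * ∏ v ∈ verts F ∩ verts G, x v) := by
        rw [Finset.prod_union_inter, pow_add, mul_mul_mul_comm]
        rfl
    _ ≤ lam ^ (F ∪ G).card * ((∏ v ∈ verts F ∪ verts G, x v) * 1) :=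
        mul_le_mul (pow_le_pow_of_le_one hlam.1 hlam.2 (Finset.card_union_le F G))
          (mul_le_mul_of_nonneg_left hinter hunion)
          (mul_nonneg hunion (Finset.prod_nonneg fun v _ => (hx v).1)) (pow_nonneg hlam.1 _)
    _ = moment lam x (F ∪ G) := by rw [mul_one, moment, verts_union]

lemma moment_le_of_nonempty (hF : F.Nonempty) : moment lam x F ≤ lam :=
  calc moment lam x F ≤ lam ^ 1 * 1 :=
        mul_le_mul (pow_le_pow_of_le_one hlam.1 hlam.2 (Finset.card_pos.2 hF))
          (Finset.prod_le_one (fun v _ => (hx v).1) fun v _ => (hx v).2)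
          (Finset.prod_nonneg fun v _ => (hx v).1) (pow_nonneg hlam.1 _)
    _ = lam := by ring

end Bounds

/-- The law `μ` of a random sign array has the moments of the planted block model, in which the
node `v` belongs to the block with probability `x v` and the signs in the block have mean `lam`. -/
structure HasBlockMoments (μ : Measure (ι × κ → ℝ)) (lam : ℝ) (x : ι ⊕ κ → ℝ) : Prop where
  lam_mem : lam ∈ Set.Icc (0 : ℝ) 1
  prob_mem : ∀ v, x v ∈ Set.Icc (0 : ℝ) 1
  mul_self_ae : ∀ᵐ Y ∂μ, ∀ e, Y e * Y e = 1
  integrable_mono : ∀ F, Integrable (mono F) μ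
  integral_mono : ∀ F, ∫ Y, mono F Y ∂μ = moment lam x F

end Moments

section MixtureLaw

lemma isProbabilityMeasure_signLaw {m : ℝ} (hm : m ∈ Set.Icc (-1 : ℝ) 1) :
    IsProbabilityMeasure (signLaw m) := by
  constructor
  simp only [signLaw, Measure.coe_add, Measure.coe_smul, Pi.add_apply, Pi.smul_apply,
    measure_univ, smul_eq_mul, mul_one]
  rw [← ENNReal.ofReal_add (by linarith [hm.1]) (by linarith [hm.2])]
  norm_num [← add_div]

lemma integrable_signLaw (m : ℝ) (f : ℝ → ℝ) : Integrable f (signLaw m) :=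
  ((integrable_dirac (by simp)).smul_measure ENNReal.ofReal_ne_top).add_measure
    ((integrable_dirac (by simp)).smul_measure ENNReal.ofReal_ne_top)

lemma integral_id_signLaw {m : ℝ} (hm : m ∈ Set.Icc (-1 : ℝ) 1) : ∫ x, x ∂(signLaw m) = m := by
  have hint := integrable_add_measure.1 (integrable_signLaw m fun x => x)
  rw [signLaw, integral_add_measure hint.1 hint.2, integral_smul_measure, integral_smul_measure,
    integral_dirac, integral_dirac, ENNReal.toReal_ofReal (by linarith [hm.1]),
    ENNReal.toReal_ofReal (by linarith [hm.2]), smul_eq_mul, smul_eq_mul]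
  ring

lemma ae_mul_self_signLaw (m : ℝ) : ∀ᵐ x ∂(signLaw m), x * x = 1 :=
  ae_add_measure_iff.2 ⟨Measure.ae_smul_measure (by simp [ae_dirac_eq]) _,
    Measure.ae_smul_measure (by simp [ae_dirac_eq]) _⟩

variable {n d : ℕ}

lemma mono_eq_prod_ite (F : Finset (Fin n × Fin d)) :
    mono F = fun Y => ∏ e, (fun y : ℝ => if e ∈ F then y else 1) (Y e) := by
  ext Y
  simp [mono, Finset.prod_ite_mem]

section CondLaw

variable {M : Fin n × Fin d → ℝ} (hM : ∀ e, M e ∈ Set.Icc (-1 : ℝ) 1)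
include hM

lemma ae_mul_self_condLaw : ∀ᵐ Y ∂(condLaw M), ∀ e, Y e * Y e = 1 := by
  have hprob := fun e => isProbabilityMeasure_signLaw (hM e)
  exact ae_all_iff.2 fun e => (Measure.tendsto_eval_ae_ae (μ := fun e => signLaw (M e))
    (i := e)).eventually (ae_mul_self_signLaw (M e))

lemma integrable_mono_condLaw (F : Finset (Fin n × Fin d)) : Integrable (mono F) (condLaw M) := by
  have hprob := fun e => isProbabilityMeasure_signLaw (hM e)
  rw [mono_eq_prod_ite]
  exact Integrable.fintype_prod_dep (f := fun e (y : ℝ) => if e ∈ F then y else 1)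
    fun e => integrable_signLaw _ _

lemma integral_mono_condLaw (F : Finset (Fin n × Fin d)) :
    ∫ Y, mono F Y ∂(condLaw M) = ∏ e ∈ F, M e := by
  have hprob := fun e => isProbabilityMeasure_signLaw (hM e)
  have hfactor (e) : ∫ y, (if e ∈ F then y else 1) ∂(signLaw (M e)) =
      if e ∈ F then M e else 1 := by
    split_ifs
    · exact integral_id_signLaw (hM e)
    · simp
  rw [mono_eq_prod_ite, condLaw, integral_fintype_prod_eq_prod (𝕜 := ℝ)
    (fun e (y : ℝ) => if e ∈ F then y else 1)]
  simp only [hfactor, Finset.prod_ite_mem, Finset.univ_inter]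

end CondLaw

lemma sum_bernoulliWeight_superset {m : ℕ} (p : ℝ) (R : Finset (Fin m)) :
    ∑ S : Finset (Fin m), bernoulliWeight p S * (if R ⊆ S then 1 else 0) = p ^ R.card := by
  have hterm (S : Finset (Fin m)) : bernoulliWeight p S * (if R ⊆ S then 1 else 0) =
      (∏ _i ∈ S, p) * ∏ i ∈ Sᶜ, if i ∈ R then 0 else 1 - p := by
    rw [bernoulliWeight, ← Finset.prod_mul_prod_compl S,
      Finset.prod_congr rfl fun i hi => if_pos hi,
      Finset.prod_congr rfl fun i hi => if_neg (Finset.mem_compl.1 hi), mul_assoc]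
    congr 1
    by_cases hRS : R ⊆ S
    · rw [if_pos hRS, mul_one]
      exact Finset.prod_congr rfl fun i hi =>
        (if_neg fun h => Finset.mem_compl.1 hi (hRS h)).symm
    · obtain ⟨i, hiR, hiS⟩ := Finset.not_subset.1 hRS
      rw [if_neg hRS, mul_zero]
      exact (Finset.prod_eq_zero (f := fun i => if i ∈ R then 0 else 1 - p)
        (Finset.mem_compl.2 hiS) (if_pos hiR)).symm
  have hfactor (i : Fin m) : (p + if i ∈ R then 0 else 1 - p) = if i ∈ R then p else 1 := by
    split_ifs <;> ring
  rw [Finset.sum_congr rfl fun S _ => hterm S, ← Fintype.prod_add (fun _ => p)]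
  simp only [hfactor, Finset.prod_ite_mem, Finset.univ_inter, Finset.prod_const]

lemma bernoulliWeight_nonneg {m : ℕ} {p : ℝ} (hp : p ∈ Set.Icc (0 : ℝ) 1) (S : Finset (Fin m)) :
    0 ≤ bernoulliWeight p S := by
  refine Finset.prod_nonneg fun i _ => ?_
  split_ifs <;> linarith [hp.1, hp.2]

lemma blockMatrix_mem_Icc {lam : ℝ} (hlam : lam ∈ Set.Icc (0 : ℝ) 1) (S : Finset (Fin n))
    (T : Finset (Fin d)) (e : Fin n × Fin d) : blockMatrix lam S T e ∈ Set.Icc (-1 : ℝ) 1 := by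
  unfold blockMatrix
  split_ifs <;> constructor <;> linarith [hlam.1, hlam.2]

lemma prod_blockMatrix (lam : ℝ) (S : Finset (Fin n)) (T : Finset (Fin d))
    (F : Finset (Fin n × Fin d)) :
    ∏ e ∈ F, blockMatrix lam S T e = lam ^ F.card *
      ((if (verts F).toLeft ⊆ S then 1 else 0) * (if (verts F).toRight ⊆ T then 1 else 0)) := by
  rw [ite_zero_mul_ite_zero, mul_one, if_congr Finset.subset_disjSum.symm rfl rfl, mul_ite,
    mul_one, mul_zero]
  split_ifs with hF
  · refine Finset.prod_eq_pow_card fun e he => if_pos ?_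
    simpa [endpoints, Finset.insert_subset_iff] using (endpoints_subset_verts he).trans hF
  · obtain ⟨e, he, hedges⟩ : ∃ e ∈ F, ¬endpoints e ⊆ S.disjSum T := by
      simpa [verts, Finset.biUnion_subset] using hF
    refine Finset.prod_eq_zero he (if_neg ?_)
    simpa [endpoints, Finset.insert_subset_iff] using hedges

lemma div_mem_Icc {K m : ℕ} (h : K ≤ m) : (K : ℝ) / m ∈ Set.Icc (0 : ℝ) 1 :=
  ⟨by positivity, div_le_one_of_le₀ (by exact_mod_cast h) (by positivity)⟩

/-- The probability that a given row or column is selected by the block of the mixture law. -/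
def selectionProb (n d Kn Kd : ℕ) : Fin n ⊕ Fin d → ℝ :=
  Sum.elim (fun _ => (Kn : ℝ) / n) fun _ => (Kd : ℝ) / d

lemma moment_selectionProb {Kn Kd : ℕ} (lam : ℝ) (F : Finset (Fin n × Fin d)) :
    moment lam (selectionProb n d Kn Kd) F = lam ^ F.card *
      (((Kn : ℝ) / n) ^ (verts F).toLeft.card * ((Kd : ℝ) / d) ^ (verts F).toRight.card) := by
  simp only [moment, Finset.prod_sum_eq_prod_toLeft_mul_prod_toRight, selectionProb, Sum.elim_inl,
    Sum.elim_inr, Finset.prod_const]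

variable {Kn Kd : ℕ} {lam : ℝ} (hlam : lam ∈ Set.Icc (0 : ℝ) 1)
include hlam

lemma integrable_mono_mixtureLaw (F : Finset (Fin n × Fin d)) :
    Integrable (mono F) (mixtureLaw n d Kn Kd lam) := by
  simp only [mixtureLaw, integrable_finsetSum_measure]
  exact fun S _ T _ => (integrable_mono_condLaw (blockMatrix_mem_Icc hlam S T) F).smul_measure
    ENNReal.ofReal_ne_top

lemma integral_mono_mixtureLaw (hKn : Kn ≤ n) (hKd : Kd ≤ d) (F : Finset (Fin n × Fin d)) :
    ∫ Y, mono F Y ∂(mixtureLaw n d Kn Kd lam) = moment lam (selectionProb n d Kn Kd) F := by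
  have hint := integrable_mono_mixtureLaw (Kn := Kn) (Kd := Kd) hlam F
  simp only [mixtureLaw, integrable_finsetSum_measure] at hint
  rw [mixtureLaw, integral_finsetSum_measure fun S hS => integrable_finsetSum_measure.2 (hint S hS),
    moment_selectionProb, ← sum_bernoulliWeight_superset, ← sum_bernoulliWeight_superset,
    Finset.sum_mul_sum, Finset.mul_sum]
  refine Finset.sum_congr rfl fun S hS => ?_
  rw [integral_finsetSum_measure (hint S hS), Finset.mul_sum]
  refine Finset.sum_congr rfl fun T _ => ?_
  rw [integral_smul_measure, integral_mono_condLaw (blockMatrix_mem_Icc hlam S T),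
    prod_blockMatrix, smul_eq_mul, ENNReal.toReal_ofReal (mul_nonneg
      (bernoulliWeight_nonneg (div_mem_Icc hKn) S) (bernoulliWeight_nonneg (div_mem_Icc hKd) T))]
  ring

lemma hasBlockMoments_mixtureLaw (hKn : Kn ≤ n) (hKd : Kd ≤ d) :
    HasBlockMoments (mixtureLaw n d Kn Kd lam) lam (selectionProb n d Kn Kd) where
  lam_mem := hlam
  prob_mem := Sum.rec (fun _ => div_mem_Icc hKn) fun _ => div_mem_Icc hKd
  mul_self_ae := by
    rw [ae_iff, mixtureLaw]
    simp only [Measure.finsetSum_apply]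
    exact Finset.sum_eq_zero fun S _ => Finset.sum_eq_zero fun T _ => ae_iff.1
      (Measure.ae_smul_measure (ae_mul_self_condLaw (blockMatrix_mem_Icc hlam S T)) _)
  integrable_mono := integrable_mono_mixtureLaw hlam
  integral_mono := integral_mono_mixtureLaw hlam hKn hKd

end MixtureLaw

section CentredProducts

/-! ### Products of centred monomials -/

variable {ι κ : Type*} [DecidableEq ι] [DecidableEq κ]

/-- The product over `C ∈ s` of the monomials of `C`, each centred by its moment. The factors form
a multiset because the two polynomials of a Gram matrix entry may have factors in common. -/
def centredProd (lam : ℝ) (x : ι ⊕ κ → ℝ) (s : Multiset (Finset (ι × κ))) (Y : ι × κ → ℝ) : ℝ :=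
  (s.map fun C => mono C Y - moment lam x C).prod

variable {μ : Measure (ι × κ → ℝ)} {lam : ℝ} {x : ι ⊕ κ → ℝ} {G C : Finset (ι × κ)}
  {s : Multiset (Finset (ι × κ))}

lemma centredProd_zero (Y : ι × κ → ℝ) : centredProd lam x 0 Y = 1 := rfl

lemma centredProd_cons (C : Finset (ι × κ)) (s : Multiset (Finset (ι × κ))) (Y : ι × κ → ℝ) :
    centredProd lam x (C ::ₘ s) Y = (mono C Y - moment lam x C) * centredProd lam x s Y := by
  simp only [centredProd, Multiset.map_cons, Multiset.prod_cons]

lemma centredProd_add (s t : Multiset (Finset (ι × κ))) (Y : ι × κ → ℝ) :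
    centredProd lam x (s + t) Y = centredProd lam x s Y * centredProd lam x t Y := by
  simp only [centredProd, Multiset.map_add, Multiset.prod_add]

namespace HasBlockMoments

variable (hμ : HasBlockMoments μ lam x)
include hμ

lemma mono_mul_centredProd_cons_ae (G C : Finset (ι × κ)) (s : Multiset (Finset (ι × κ))) :
    (fun Y => mono G Y * centredProd lam x (C ::ₘ s) Y) =ᵐ[μ] fun Y =>
      mono (symmDiff G C) Y * centredProd lam x s Y -
        moment lam x C * (mono G Y * centredProd lam x s Y) := by
  filter_upwards [hμ.mul_self_ae] with Y hY
  rw [centredProd_cons, ← mono_mul_mono_of_mul_self_eq_one hY]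
  ring

lemma integrable_mono_mul_centredProd (s : Multiset (Finset (ι × κ))) (G : Finset (ι × κ)) :
    Integrable (fun Y => mono G Y * centredProd lam x s Y) μ := by
  induction s using Multiset.induction_on generalizing G with
  | empty => simpa only [centredProd_zero, mul_one] using hμ.integrable_mono G
  | cons C s ih =>
    exact ((ih _).sub ((ih G).const_mul _)).congr (hμ.mono_mul_centredProd_cons_ae G C s).symm

lemma integral_mono_mul_centredProd_cons (G C : Finset (ι × κ))
    (s : Multiset (Finset (ι × κ))) :
    ∫ Y, mono G Y * centredProd lam x (C ::ₘ s) Y ∂μ =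
      ∫ Y, mono (symmDiff G C) Y * centredProd lam x s Y ∂μ -
        moment lam x C * ∫ Y, mono G Y * centredProd lam x s Y ∂μ := by
  rw [integral_congr_ae (hμ.mono_mul_centredProd_cons_ae G C s),
    integral_sub (hμ.integrable_mono_mul_centredProd _ _)
      ((hμ.integrable_mono_mul_centredProd _ _).const_mul _), integral_const_mul]

lemma integral_mono_symmDiff_mul_centredProd (hG : Disjoint (verts C) (verts G))
    (hs : ∀ C' ∈ s, Disjoint (verts C) (verts C')) :
    ∫ Y, mono (symmDiff G C) Y * centredProd lam x s Y ∂μ =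
      moment lam x C * ∫ Y, mono G Y * centredProd lam x s Y ∂μ := by
  induction s using Multiset.induction_on generalizing G with
  | empty =>
    simp only [centredProd_zero, mul_one, hμ.integral_mono]
    rw [(disjoint_of_disjoint_verts hG.symm).symmDiff_eq_sup, Finset.sup_eq_union,
      moment_union_of_disjoint lam x hG.symm, mul_comm]
  | cons C' s ih =>
    have hs' := fun C'' h => hs C'' (Multiset.mem_cons_of_mem h)
    have hGC' : Disjoint (verts C) (verts (symmDiff G C')) := by
      refine Disjoint.mono_right (verts_mono symmDiff_le_sup) ?_
      rw [Finset.sup_eq_union, verts_union]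
      exact Finset.disjoint_union_right.2 ⟨hG, hs C' (Multiset.mem_cons_self C' s)⟩
    rw [hμ.integral_mono_mul_centredProd_cons, hμ.integral_mono_mul_centredProd_cons,
      symmDiff_right_comm, ih hGC' hs', ih hG hs']
    ring

lemma integral_mono_mul_centredProd_cons_eq_zero (hG : Disjoint (verts C) (verts G))
    (hs : ∀ C' ∈ s, Disjoint (verts C) (verts C')) :
    ∫ Y, mono G Y * centredProd lam x (C ::ₘ s) Y ∂μ = 0 := by
  rw [hμ.integral_mono_mul_centredProd_cons, hμ.integral_mono_symmDiff_mul_centredProd hG hs,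
    sub_self]

lemma integral_mono_mul_centredProd_cons_cons (hG : Disjoint (verts C) (verts G))
    (hs : ∀ C' ∈ s, Disjoint (verts C) (verts C')) :
    ∫ Y, mono G Y * centredProd lam x (C ::ₘ C ::ₘ s) Y ∂μ =
      (1 - moment lam x C ^ 2) * ∫ Y, mono G Y * centredProd lam x s Y ∂μ := by
  rw [hμ.integral_mono_mul_centredProd_cons, hμ.integral_mono_mul_centredProd_cons_eq_zero hG hs,
    hμ.integral_mono_mul_centredProd_cons, symmDiff_symmDiff_cancel_right,
    hμ.integral_mono_symmDiff_mul_centredProd hG hs]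
  ring

lemma integral_centredProd_add_add {I : Finset (Finset (ι × κ))}
    (hI : (I : Set (Finset (ι × κ))).PairwiseDisjoint verts)
    (hs : ∀ C ∈ I, ∀ C' ∈ s, Disjoint (verts C) (verts C')) :
    ∫ Y, centredProd lam x (I.val + I.val + s) Y ∂μ =
      (∏ C ∈ I, (1 - moment lam x C ^ 2)) * ∫ Y, centredProd lam x s Y ∂μ := by
  induction I using Finset.induction_on with
  | empty => simp
  | insert C I hC ih =>
    rw [Finset.coe_insert, Set.pairwiseDisjoint_insert] at hI
    have hdisj : ∀ C' ∈ I.val + I.val + s, Disjoint (verts C) (verts C') := by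
      simp only [Multiset.mem_add, or_self]
      rintro C' (hC' | hC')
      · exact hI.2 C' hC' fun h => hC (h ▸ hC')
      · exact hs C (Finset.mem_insert_self C I) C' hC'
    have hcons := hμ.integral_mono_mul_centredProd_cons_cons
      (G := ∅) (by simp [verts]) hdisj
    simp only [mono_empty, one_mul] at hcons
    rw [Finset.insert_val_of_notMem hC, Multiset.cons_add, Multiset.add_cons, Multiset.cons_add,
      Multiset.cons_add, hcons, ih hI.1 fun C' hC' => hs C' (Finset.mem_insert_of_mem hC'),
      Finset.prod_insert hC, mul_assoc]

lemma abs_integral_mono_mul_centredProd_le (s : Multiset (Finset (ι × κ)))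
    (G : Finset (ι × κ)) :
    |∫ Y, mono G Y * centredProd lam x s Y ∂μ| ≤
      2 ^ Multiset.card s * moment lam x (s.fold symmDiff G) := by
  induction s using Multiset.induction_on generalizing G with
  | empty =>
    simp only [centredProd_zero, mul_one, hμ.integral_mono, Multiset.card_zero, pow_zero, one_mul,
      Multiset.fold_zero]
    exact (abs_of_nonneg (moment_nonneg hμ.lam_mem hμ.prob_mem G)).le
  | cons C s ih =>
    have hC := moment_nonneg hμ.lam_mem hμ.prob_mem C
    have hmul : moment lam x C * moment lam x (s.fold symmDiff G) ≤
        moment lam x (symmDiff C (s.fold symmDiff G)) :=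
      (moment_mul_moment_le hμ.lam_mem hμ.prob_mem _ _).trans
        (moment_anti hμ.lam_mem hμ.prob_mem symmDiff_le_sup)
    have hfirst := ih (symmDiff G C)
    rw [← Multiset.fold_cons'_right, Multiset.fold_cons_left] at hfirst
    rw [hμ.integral_mono_mul_centredProd_cons, Multiset.card_cons, Multiset.fold_cons_left]
    calc _ ≤ _ := abs_sub _ _
      _ ≤ 2 ^ Multiset.card s * moment lam x (symmDiff C (s.fold symmDiff G)) +
          moment lam x C * (2 ^ Multiset.card s * moment lam x (s.fold symmDiff G)) := by
        rw [abs_mul, abs_of_nonneg hC]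
        exact add_le_add hfirst (mul_le_mul_of_nonneg_left (ih G) hC)
      _ ≤ 2 ^ (Multiset.card s + 1) * moment lam x (symmDiff C (s.fold symmDiff G)) := by
        rw [mul_left_comm, pow_succ, mul_assoc, two_mul, mul_add]
        gcongr

end HasBlockMoments

end CentredProducts

section CentredPolynomials

/-! ### Near-orthonormality of the centred polynomials -/

lemma fold_symmDiff_eq_sup {α : Type*} [DecidableEq α] {P : Finset (Finset α)}
    (hP : (P : Set (Finset α)).PairwiseDisjoint id) : P.val.fold symmDiff ∅ = P.sup id := by
  induction P using Finset.induction_on with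
  | empty => rfl
  | insert C P hC ih =>
    rw [Finset.coe_insert, Set.pairwiseDisjoint_insert_of_notMem (mod_cast hC)] at hP
    rw [Finset.insert_val_of_notMem hC, Multiset.fold_cons_left, ih hP.1, Finset.sup_insert]
    exact (Finset.disjoint_sup_right.2 hP.2).symmDiff_eq_sup

variable {ι κ : Type*} [DecidableEq ι] [DecidableEq κ]

/-- The polynomial attached to an edge set `A`: the product over the connected components of `A`
of their monomials, each centred by its moment. -/
def centredPoly (lam : ℝ) (x : ι ⊕ κ → ℝ) (A : Finset (ι × κ)) : (ι × κ → ℝ) → ℝ :=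
  centredProd lam x (connectedParts A).parts.val

lemma centredPoly_empty (lam : ℝ) (x : ι ⊕ κ → ℝ) (Y : ι × κ → ℝ) :
    centredPoly lam x ∅ Y = 1 := by
  rw [centredPoly, Finset.val_eq_zero.2 (Finpartition.parts_eq_empty_iff.2 rfl), centredProd_zero]

lemma fold_symmDiff_connectedParts (A : Finset (ι × κ)) :
    (connectedParts A).parts.val.fold symmDiff ∅ = A := by
  rw [fold_symmDiff_eq_sup (connectedParts A).disjoint, (connectedParts A).sup_parts]

/-- The components of exactly one of the edge sets `A` and `B`. -/
def unsharedParts (A B : Finset (ι × κ)) : Multiset (Finset (ι × κ)) :=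
  ((connectedParts A).parts \ (connectedParts B).parts).val +
    ((connectedParts B).parts \ (connectedParts A).parts).val

lemma connectedParts_val_add_val (A B : Finset (ι × κ)) :
    (connectedParts A).parts.val + (connectedParts B).parts.val =
      ((connectedParts A).parts ∩ (connectedParts B).parts).val +
        ((connectedParts A).parts ∩ (connectedParts B).parts).val + unsharedParts A B := by
  have hA := Multiset.sub_add_inter (connectedParts A).parts.val (connectedParts B).parts.val
  have hB := Multiset.sub_add_inter (connectedParts B).parts.val (connectedParts A).parts.val
  rw [Multiset.inter_comm] at hB
  rw [unsharedParts, Finset.sdiff_val, Finset.sdiff_val, Finset.inter_val, add_add_add_comm,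
    add_comm (_ ∩ _), add_comm (_ ∩ _), hA, hB]

lemma fold_symmDiff_unsharedParts (A B : Finset (ι × κ)) :
    (unsharedParts A B).fold symmDiff ∅ = symmDiff A B := by
  have hadd (s t : Multiset (Finset (ι × κ))) :
      (s + t).fold symmDiff ∅ = symmDiff (s.fold symmDiff ∅) (t.fold symmDiff ∅) := by
    simpa only [symmDiff_self, Finset.bot_eq_empty] using Multiset.fold_add symmDiff ∅ ∅ s t
  have h := congr_arg (Multiset.fold symmDiff ∅) (connectedParts_val_add_val A B)
  rwa [hadd, hadd, hadd, fold_symmDiff_connectedParts, fold_symmDiff_connectedParts,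
    symmDiff_self, bot_symmDiff, eq_comm] at h

lemma card_unsharedParts_le (A B : Finset (ι × κ)) :
    Multiset.card (unsharedParts A B) ≤ (symmDiff A B).card * 4 := by
  have hAB := card_connectedParts_sdiff_le A B
  have hBA := card_connectedParts_sdiff_le B A
  rw [symmDiff_comm] at hBA
  rw [unsharedParts, Multiset.card_add, Finset.card_val, Finset.card_val]
  omega

namespace HasBlockMoments

variable {μ : Measure (ι × κ → ℝ)} {lam : ℝ} {x : ι ⊕ κ → ℝ} (hμ : HasBlockMoments μ lam x)
include hμ

lemma integrable_centredPoly_mul (A B : Finset (ι × κ)) :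
    Integrable (fun Y => centredPoly lam x A Y * centredPoly lam x B Y) μ := by
  have h := hμ.integrable_mono_mul_centredProd
    ((connectedParts A).parts.val + (connectedParts B).parts.val) ∅
  simpa only [mono_empty, one_mul, centredPoly, centredProd_add] using h

lemma integral_centredPoly_mul (A B : Finset (ι × κ)) :
    ∫ Y, centredPoly lam x A Y * centredPoly lam x B Y ∂μ =
      (∏ C ∈ (connectedParts A).parts ∩ (connectedParts B).parts, (1 - moment lam x C ^ 2)) *
        ∫ Y, centredProd lam x (unsharedParts A B) Y ∂μ := by
  rw [← hμ.integral_centredProd_add_add, ← connectedParts_val_add_val]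
  · simp only [centredPoly, centredProd_add]
  · exact (pairwiseDisjoint_verts A).subset (Finset.coe_subset.2 Finset.inter_subset_left)
  · intro C hC C' hC'
    obtain ⟨hCA, hCB⟩ := Finset.mem_inter.1 hC
    rcases Multiset.mem_add.1 hC' with h | h <;>
      obtain ⟨hmem, hnot⟩ := Finset.mem_sdiff.1 h
    · exact pairwiseDisjoint_verts A hCA hmem fun heq => hnot (heq ▸ hCB)
    · exact pairwiseDisjoint_verts B hCB hmem fun heq => hnot (heq ▸ hCA)

lemma moment_sq_mem_Icc {C : Finset (ι × κ)} (hC : C.Nonempty) :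
    moment lam x C ^ 2 ∈ Set.Icc 0 lam := by
  have h0 := moment_nonneg hμ.lam_mem hμ.prob_mem C
  have hle := moment_le_of_nonempty hμ.lam_mem hμ.prob_mem hC
  exact ⟨by positivity, by nlinarith [hμ.lam_mem.2]⟩

lemma abs_integral_centredPoly_mul_le (A B : Finset (ι × κ)) :
    |∫ Y, centredPoly lam x A Y * centredPoly lam x B Y ∂μ| ≤
      16 ^ (symmDiff A B).card * moment lam x (symmDiff A B) := by
  have hprod : |∏ C ∈ (connectedParts A).parts ∩ (connectedParts B).parts,
      (1 - moment lam x C ^ 2)| ≤ 1 := by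
    rw [Finset.abs_prod]
    refine Finset.prod_le_one (fun _ _ => abs_nonneg _) fun C hC => ?_
    have hsq := hμ.moment_sq_mem_Icc
      ((connectedParts A).nonempty_of_mem_parts (Finset.mem_inter.1 hC).1)
    exact abs_le.2 ⟨by linarith [hsq.2, hμ.lam_mem.2], by linarith [hsq.1]⟩
  have hrest := hμ.abs_integral_mono_mul_centredProd_le (unsharedParts A B) ∅
  simp only [mono_empty, one_mul, fold_symmDiff_unsharedParts] at hrest
  rw [hμ.integral_centredPoly_mul, abs_mul]
  calc _ ≤ 1 * (2 ^ ((symmDiff A B).card * 4) * moment lam x (symmDiff A B)) := by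
        refine mul_le_mul hprod (hrest.trans ?_) (abs_nonneg _) zero_le_one
        exact mul_le_mul_of_nonneg_right
          (pow_le_pow_right₀ one_le_two (card_unsharedParts_le A B))
          (moment_nonneg hμ.lam_mem hμ.prob_mem _)
    _ = _ := by
        rw [one_mul, mul_comm _ 4, pow_mul]
        norm_num

lemma integral_centredPoly_mul_eq_zero {A B : Finset (ι × κ)} (hAB : ¬EachPartMeets A B) :
    ∫ Y, centredPoly lam x A Y * centredPoly lam x B Y ∂μ = 0 := by
  simp only [EachPartMeets, not_forall, not_not] at hAB
  obtain ⟨C, hC, hCB⟩ := hAB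
  have hdisj : ∀ C' ∈ (connectedParts A).parts.val.erase C + (connectedParts B).parts.val,
      Disjoint (verts C) (verts C') := by
    intro C' hC'
    rcases Multiset.mem_add.1 hC' with h | h
    · have := (Multiset.Nodup.mem_erase_iff (connectedParts A).parts.nodup).1 h
      exact pairwiseDisjoint_verts A hC this.2 this.1.symm
    · exact hCB.mono_right (verts_mono ((connectedParts B).le h))
  have hzero := hμ.integral_mono_mul_centredProd_cons_eq_zero (G := ∅) (by simp [verts]) hdisj
  rw [← Multiset.cons_add, Multiset.cons_erase hC] at hzero
  simpa only [mono_empty, one_mul, centredPoly, centredProd_add] using hzero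

lemma one_sub_le_prod_one_sub_moment_sq (A : Finset (ι × κ)) :
    1 - A.card * lam ≤ ∏ C ∈ (connectedParts A).parts, (1 - moment lam x C ^ 2) := by
  have hlam := hμ.lam_mem
  calc 1 - A.card * lam ≤ (1 - lam) ^ A.card := by
        have := one_add_mul_le_pow (a := -lam) (by linarith [hlam.2]) A.card
        rwa [mul_neg, ← sub_eq_add_neg, ← sub_eq_add_neg] at this
    _ ≤ (1 - lam) ^ (connectedParts A).parts.card :=
        pow_le_pow_of_le_one (by linarith [hlam.2]) (by linarith [hlam.1])
          (connectedParts A).card_parts_le_card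
    _ ≤ _ := by
        rw [← Finset.prod_const]
        exact Finset.prod_le_prod (fun _ _ => by linarith [hlam.2]) fun C hC => by
          linarith [(hμ.moment_sq_mem_Icc ((connectedParts A).nonempty_of_mem_parts hC)).2]

lemma abs_integral_centredPoly_mul_self_sub_one_le (A : Finset (ι × κ)) :
    |∫ Y, centredPoly lam x A Y * centredPoly lam x A Y ∂μ - 1| ≤ A.card * lam := by
  have hone : ∫ _, (1 : ℝ) ∂μ = 1 := by
    simpa only [mono_empty, moment, verts, Finset.card_empty, pow_zero, Finset.biUnion_empty,
      Finset.prod_empty, one_mul] using hμ.integral_mono ∅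
  have hself : unsharedParts A A = 0 := by
    rw [unsharedParts, sdiff_self, Finset.bot_eq_empty, Finset.empty_val, add_zero]
  have hle : ∏ C ∈ (connectedParts A).parts, (1 - moment lam x C ^ 2) ≤ 1 :=
    Finset.prod_le_one
      (fun C hC => by
        linarith [(hμ.moment_sq_mem_Icc ((connectedParts A).nonempty_of_mem_parts hC)).2,
          hμ.lam_mem.2])
      fun C _ => sub_le_self 1 (sq_nonneg _)
  rw [hμ.integral_centredPoly_mul, hself, Finset.inter_self]
  simp only [centredProd_zero, hone, mul_one]
  rw [abs_sub_comm, abs_of_nonneg (by linarith)]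
  linarith [hμ.one_sub_le_prod_one_sub_moment_sq A]

end HasBlockMoments

end CentredPolynomials

section Counting

/-! ### Weighted counting of edge sets -/

lemma sum_powersetCard_succ_le_sum_insert {α : Type*} [Fintype α] [DecidableEq α]
    {g : Finset α → ℝ} (hg : ∀ F, 0 ≤ g F) (m : ℕ) :
    ∑ F ∈ Finset.powersetCard (m + 1) Finset.univ, g F ≤
      ∑ F ∈ Finset.powersetCard m Finset.univ, ∑ e, g (insert e F) := by
  rw [← Finset.sum_product']
  refine (Finset.sum_le_sum_of_subset_of_nonneg (fun F hF => ?_) fun F _ _ => hg F).trans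
    (Finset.sum_image_le_of_nonneg (g := fun p : Finset α × α => insert p.2 p.1) fun F _ => hg F)
  have hcard := (Finset.mem_powersetCard.1 hF).2
  obtain ⟨e, he⟩ : F.Nonempty := Finset.card_pos.1 (by omega)
  refine Finset.mem_image.2 ⟨(F.erase e, e), ?_, Finset.insert_erase he⟩
  simp [Finset.card_erase_of_mem he, hcard]

lemma sum_ite_notMem_le {α β : Type*} [Fintype α] [DecidableEq β] {j : α → β}
    (hj : Function.Injective j) {f : α → ℝ} (hf : ∀ a, 0 ≤ f a) (hsum : ∑ a, f a ≤ 1)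
    (Z : Finset β) : ∑ a, (if j a ∉ Z then f a else 1) ≤ Z.card + 1 := by
  have hcard : (Finset.univ.filter fun a => j a ∈ Z).card ≤ Z.card :=
    Finset.card_le_card_of_injOn j (fun a ha => (Finset.mem_filter.1 ha).2) hj.injOn
  calc ∑ a, (if j a ∉ Z then f a else 1) ≤ ∑ a, ((if j a ∈ Z then 1 else 0) + f a) := by
        refine Finset.sum_le_sum fun a _ => ?_
        by_cases ha : j a ∈ Z <;> simp [ha, hf a]
    _ = (Finset.univ.filter fun a => j a ∈ Z).card + ∑ a, f a := by
        rw [Finset.sum_add_distrib, Finset.sum_boole]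
    _ ≤ Z.card + 1 := add_le_add (by exact_mod_cast hcard) hsum

lemma prod_symmDiff_mul_prod {V : Type*} [DecidableEq V] (S T : Finset V) (u : V → ℝ) :
    (∏ v ∈ symmDiff S T, u v) * ∏ v ∈ T, u v = (∏ v ∈ S, u v) * ∏ v ∈ T \ S, u v ^ 2 := by
  rw [Finset.prod_pow, symmDiff_def, Finset.sup_eq_union,
    Finset.prod_union disjoint_sdiff_sdiff, ← Finset.prod_inter_mul_prod_sdiff T S,
    ← Finset.prod_inter_mul_prod_sdiff S T, Finset.inter_comm]
  ring

variable {ι κ : Type*} [DecidableEq ι] [DecidableEq κ]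

/-- The weight `∏ u_v` over the nodes met by `A`, which serves as test function in the Schur
test. -/
def schurWeight (u : ι ⊕ κ → ℝ) (A : Finset (ι × κ)) : ℝ := ∏ v ∈ verts A, u v

/-- The weight `∏ u_v²` over the nodes met by `F` that lie outside `Z`. -/
def outsideWeight (u : ι ⊕ κ → ℝ) (Z : Finset (ι ⊕ κ)) (F : Finset (ι × κ)) : ℝ :=
  ∏ v ∈ verts F \ Z, u v ^ 2

variable {u : ι ⊕ κ → ℝ} {Z : Finset (ι ⊕ κ)}

lemma outsideWeight_nonneg (F : Finset (ι × κ)) : 0 ≤ outsideWeight u Z F :=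
  Finset.prod_nonneg fun v _ => sq_nonneg (u v)

lemma outsideWeight_insert (e : ι × κ) (F : Finset (ι × κ)) :
    outsideWeight u Z (insert e F) =
      outsideWeight u Z F * ∏ v ∈ endpoints e \ (Z ∪ verts F), u v ^ 2 := by
  rw [outsideWeight, outsideWeight, verts_insert, ← Finset.prod_union]
  · congr 1
    ext v
    simp only [Finset.mem_sdiff, Finset.mem_union]
    tauto
  · exact Finset.disjoint_left.2 fun v hF he => (Finset.mem_sdiff.1 he).2
      (Finset.mem_union_right Z (Finset.mem_sdiff.1 hF).1)

variable [Fintype ι] [Fintype κ]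

/-- Positive node weights whose squares have sum at most one over the rows and at most one over the
columns. -/
structure IsNodeWeight (u : ι ⊕ κ → ℝ) : Prop where
  pos : ∀ v, 0 < u v
  sum_rows_le : ∑ i, u (Sum.inl i) ^ 2 ≤ 1
  sum_cols_le : ∑ k, u (Sum.inr k) ^ 2 ≤ 1

namespace IsNodeWeight

variable (hu : IsNodeWeight u)
include hu

lemma schurWeight_pos (A : Finset (ι × κ)) : 0 < schurWeight u A :=
  Finset.prod_pos fun v _ => hu.pos v

lemma sum_prod_endpoints_sdiff_le (Z : Finset (ι ⊕ κ)) :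
    ∑ e : ι × κ, ∏ v ∈ endpoints e \ Z, u v ^ 2 ≤ ((Z.card : ℝ) + 1) ^ 2 := by
  have hfactor (e : ι × κ) : ∏ v ∈ endpoints e \ Z, u v ^ 2 =
      (if Sum.inl e.1 ∉ Z then u (Sum.inl e.1) ^ 2 else 1) *
        if Sum.inr e.2 ∉ Z then u (Sum.inr e.2) ^ 2 else 1 := by
    rw [Finset.sdiff_eq_filter, Finset.prod_filter, endpoints, Finset.prod_pair Sum.inl_ne_inr]
  have hnonneg : 0 ≤ ∑ k, if Sum.inr k ∉ Z then u (Sum.inr k) ^ 2 else 1 :=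
    Finset.sum_nonneg fun k _ => by split_ifs <;> positivity
  simp only [hfactor, Fintype.sum_prod_type, ← Finset.mul_sum, ← Finset.sum_mul,
    sq ((Z.card : ℝ) + 1)]
  exact mul_le_mul
    (sum_ite_notMem_le Sum.inl_injective (fun _ => sq_nonneg _) hu.sum_rows_le Z)
    (sum_ite_notMem_le Sum.inr_injective (fun _ => sq_nonneg _) hu.sum_cols_le Z)
    hnonneg (by positivity)

lemma sum_powersetCard_outsideWeight_le {M : ℕ} (m : ℕ) (hM : Z.card + m * 2 ≤ M) :
    ∑ F ∈ Finset.powersetCard m (Finset.univ : Finset (ι × κ)), outsideWeight u Z F ≤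
      (((M : ℝ) + 1) ^ 2) ^ m := by
  induction m with
  | zero => simp [outsideWeight, verts]
  | succ m ih =>
    have hstep : ∀ F ∈ Finset.powersetCard m (Finset.univ : Finset (ι × κ)),
        ∑ e, outsideWeight u Z (insert e F) ≤ outsideWeight u Z F * ((M : ℝ) + 1) ^ 2 := by
      intro F hF
      have hcard : (Z ∪ verts F).card ≤ M := by
        have := Finset.card_union_le Z (verts F)
        have := card_verts_le F
        have := (Finset.mem_powersetCard.1 hF).2
        omega
      simp only [outsideWeight_insert, ← Finset.mul_sum]
      refine mul_le_mul_of_nonneg_left ((hu.sum_prod_endpoints_sdiff_le _).trans ?_)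
        (outsideWeight_nonneg F)
      gcongr
    calc _ ≤ _ := sum_powersetCard_succ_le_sum_insert outsideWeight_nonneg m
      _ ≤ _ := Finset.sum_le_sum hstep
      _ ≤ _ := by
        rw [← Finset.sum_mul, pow_succ]
        exact mul_le_mul_of_nonneg_right (ih (by omega)) (by positivity)

lemma sum_pow_mul_outsideWeight_le {y : ℝ} (hy : 0 ≤ y) {M m : ℕ} (hM : Z.card + m * 2 ≤ M)
    (hyM : y * ((M : ℝ) + 1) ^ 2 ≤ 1 / 2) :
    ∑ F : Finset (ι × κ) with F.card ∈ Finset.Ico 1 (m + 1), y ^ F.card * outsideWeight u Z F ≤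
      2 * (y * ((M : ℝ) + 1) ^ 2) := by
  set q := y * ((M : ℝ) + 1) ^ 2 with hq
  have hslice : ∀ f ∈ Finset.Ico 1 (m + 1),
      ∑ F ∈ Finset.univ.filter (fun F : Finset (ι × κ) => F.card ∈ Finset.Ico 1 (m + 1))
        with F.card = f, y ^ F.card * outsideWeight u Z F ≤ q ^ f := fun f hf => by
    calc _ = ∑ F ∈ Finset.powersetCard f (Finset.univ : Finset (ι × κ)),
          y ^ f * outsideWeight u Z F := by
          refine Finset.sum_congr ?_ fun F hF => by rw [(Finset.mem_powersetCard.1 hF).2]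
          ext F
          simp only [Finset.mem_filter, Finset.mem_univ, true_and, Finset.mem_powersetCard,
            Finset.subset_univ, and_iff_right_iff_imp]
          exact fun h => h ▸ hf
      _ ≤ q ^ f := by
          rw [← Finset.mul_sum, hq, mul_pow]
          refine mul_le_mul_of_nonneg_left (hu.sum_powersetCard_outsideWeight_le f ?_)
            (pow_nonneg hy f)
          have := Finset.mem_Ico.1 hf
          omega
  rw [← Finset.sum_fiberwise_of_maps_to fun F hF => (Finset.mem_filter.1 hF).2]
  calc _ ≤ ∑ f ∈ Finset.Ico 1 (m + 1), q ^ f := Finset.sum_le_sum hslice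
    _ ≤ q ^ 1 / (1 - q) := geom_sum_Ico_le_of_lt_one (by positivity) (by linarith)
    _ ≤ 2 * q := by
        have hq0 : 0 ≤ q := by positivity
        rw [div_le_iff₀ (by linarith)]
        nlinarith

end IsNodeWeight

end Counting

section SchurTest

/-! ### The Schur test -/

lemma abs_mul_mul_le_weighted {a b v w : ℝ} (hv : 0 < v) (hw : 0 < w) (k : ℝ) :
    |a * b * k| ≤ a ^ 2 / v * (|k| * w) / 2 + b ^ 2 / w * (|k| * v) / 2 := by
  have hab : |a * b| ≤ a ^ 2 / v * w / 2 + b ^ 2 / w * v / 2 := by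
    rw [abs_mul, ← sq_abs a, ← sq_abs b, div_mul_eq_mul_div, div_mul_eq_mul_div, div_div, div_div,
      div_add_div _ _ (by positivity) (by positivity), le_div_iff₀ (by positivity)]
    nlinarith [sq_nonneg (|a| * w - |b| * v)]
  calc |a * b * k| = |a * b| * |k| := abs_mul _ _
    _ ≤ (a ^ 2 / v * w / 2 + b ^ 2 / w * v / 2) * |k| := by gcongr
    _ = _ := by ring

variable {α : Type*} {s : Finset α} {k : α → α → ℝ} {w : α → ℝ} {δ : ℝ}

lemma schur_test (hk : ∀ a ∈ s, ∀ b ∈ s, k a b = k b a) (hw : ∀ a ∈ s, 0 < w a)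
    (hrow : ∀ a ∈ s, ∑ b ∈ s, |k a b| * w b ≤ δ * w a) (c : α → ℝ) :
    |∑ a ∈ s, ∑ b ∈ s, c a * c b * k a b| ≤ δ * ∑ a ∈ s, c a ^ 2 := by
  have hhalf : ∑ a ∈ s, ∑ b ∈ s, c a ^ 2 / w a * (|k a b| * w b) / 2 ≤
      δ * (∑ a ∈ s, c a ^ 2) / 2 := by
    rw [Finset.mul_sum, Finset.sum_div]
    refine Finset.sum_le_sum fun a ha => ?_
    rw [← Finset.sum_div, ← Finset.mul_sum]
    have hwa := hw a ha
    calc _ ≤ c a ^ 2 / w a * (δ * w a) / 2 := by gcongr; exact hrow a ha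
      _ = δ * c a ^ 2 / 2 := by field_simp
  calc _ ≤ ∑ a ∈ s, ∑ b ∈ s, |c a * c b * k a b| :=
        (Finset.abs_sum_le_sum_abs _ _).trans
          (Finset.sum_le_sum fun a _ => Finset.abs_sum_le_sum_abs _ _)
    _ ≤ ∑ a ∈ s, ∑ b ∈ s, (c a ^ 2 / w a * (|k a b| * w b) / 2 +
        c b ^ 2 / w b * (|k b a| * w a) / 2) :=
      Finset.sum_le_sum fun a ha => Finset.sum_le_sum fun b hb => by
        rw [hk b hb a ha]
        exact abs_mul_mul_le_weighted (hw a ha) (hw b hb) (k a b)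
    _ = (∑ a ∈ s, ∑ b ∈ s, c a ^ 2 / w a * (|k a b| * w b) / 2) +
        ∑ b ∈ s, ∑ a ∈ s, c b ^ 2 / w b * (|k b a| * w a) / 2 := by
      simp only [Finset.sum_add_distrib]
      congr 1
      exact Finset.sum_comm
    _ ≤ _ := by linarith

variable {Ω : Type*} [MeasurableSpace Ω] {μ : Measure Ω} {f : α → Ω → ℝ}

lemma integral_sq_sum (hf : ∀ a ∈ s, ∀ b ∈ s, Integrable (fun y => f a y * f b y) μ)
    (c : α → ℝ) :
    ∫ y, (∑ a ∈ s, c a * f a y) ^ 2 ∂μ =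
      ∑ a ∈ s, ∑ b ∈ s, c a * c b * ∫ y, f a y * f b y ∂μ := by
  have hint : ∀ a ∈ s, ∀ b ∈ s, Integrable (fun y => c a * c b * (f a y * f b y)) μ :=
    fun a ha b hb => (hf a ha b hb).const_mul _
  simp only [sq, Finset.sum_mul_sum, mul_mul_mul_comm (c _) (f _ _)]
  rw [integral_finsetSum _ fun a ha => integrable_finsetSum _ fun b hb => hint a ha b hb]
  refine Finset.sum_congr rfl fun a ha => ?_
  rw [integral_finsetSum _ fun b hb => hint a ha b hb]
  simp only [integral_const_mul]

lemma abs_integral_sq_sum_sub_le [DecidableEq α]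
    (hf : ∀ a ∈ s, ∀ b ∈ s, Integrable (fun y => f a y * f b y) μ) (hw : ∀ a ∈ s, 0 < w a)
    (hrow : ∀ a ∈ s,
      ∑ b ∈ s, |∫ y, f a y * f b y ∂μ - if a = b then 1 else 0| * w b ≤ δ * w a)
    (c : α → ℝ) :
    |∫ y, (∑ a ∈ s, c a * f a y) ^ 2 ∂μ - ∑ a ∈ s, c a ^ 2| ≤ δ * ∑ a ∈ s, c a ^ 2 := by
  have hidentity : ∑ a ∈ s, c a ^ 2 = ∑ a ∈ s, ∑ b ∈ s, c a * c b * if a = b then 1 else 0 :=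
    Finset.sum_congr rfl fun a ha => by simp [ha, sq]
  rw [integral_sq_sum hf]
  conv_lhs => rw [hidentity]
  simp only [← Finset.sum_sub_distrib, ← mul_sub]
  refine schur_test (fun a _ b _ => ?_) hw hrow c
  simp only [mul_comm (f a _), eq_comm (a := a)]

end SchurTest

section NearOrthonormality

variable {ι κ : Type*} [DecidableEq ι] [DecidableEq κ] {μ : Measure (ι × κ → ℝ)} {lam ε : ℝ}
  {x u : ι ⊕ κ → ℝ}

lemma IsNodeWeight.sum_pow_card_symmDiff_mul_outsideWeight_le [Fintype ι] [Fintype κ]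
    (hu : IsNodeWeight u) (hε : 0 ≤ ε) {D : ℕ} (hD : 1 ≤ D) (hDε : 2048 * (D : ℝ) ^ 2 * ε ≤ 1)
    {A : Finset (ι × κ)} (hA : A.card ≤ D) :
    ∑ B ∈ (Finset.univ.filter fun B => B.card ≤ D).erase A,
      (16 * ε) ^ (symmDiff A B).card * outsideWeight u (verts A) (symmDiff A B) ≤
        2047 * (D : ℝ) ^ 2 * ε := by
  have hM : 16 * ε * (((6 * D : ℕ) : ℝ) + 1) ^ 2 ≤ 784 * ((D : ℝ) ^ 2 * ε) := by
    have hD' : (1 : ℝ) ≤ D := by exact_mod_cast hD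
    have hsq : (((6 * D : ℕ) : ℝ) + 1) ^ 2 ≤ 49 * (D : ℝ) ^ 2 := by
      push_cast
      nlinarith
    linarith [mul_le_mul_of_nonneg_left hsq hε]
  have hcount := hu.sum_pow_mul_outsideWeight_le (y := 16 * ε) (Z := verts A) (M := 6 * D)
    (m := 2 * D) (by positivity) (by linarith [card_verts_le A]) (by linarith)
  rw [← Finset.sum_image (f := fun F => (16 * ε) ^ F.card * outsideWeight u (verts A) F)
    fun B _ B' _ hBB => symmDiff_right_injective A hBB]
  calc _ ≤ _ := Finset.sum_le_sum_of_subset_of_nonneg ?_ fun F _ _ =>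
        mul_nonneg (by positivity) (outsideWeight_nonneg F)
    _ ≤ _ := hcount
    _ ≤ _ := by nlinarith
  intro F hF
  obtain ⟨B, hB, rfl⟩ := Finset.mem_image.1 hF
  obtain ⟨hne, hBs⟩ := Finset.mem_erase.1 hB
  have hBD : B.card ≤ D := (Finset.mem_filter.1 hBs).2
  have hpos : 0 < (symmDiff A B).card :=
    Finset.card_pos.2 (Finset.symmDiff_nonempty.2 hne.symm)
  have hle : (symmDiff A B).card ≤ A.card + B.card :=
    (Finset.card_le_card symmDiff_le_sup).trans (Finset.card_union_le A B)
  exact Finset.mem_filter.2 ⟨Finset.mem_univ _, Finset.mem_Ico.2 ⟨hpos, by omega⟩⟩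

namespace HasBlockMoments

variable (hμ : HasBlockMoments μ lam x) (hlamε : lam ≤ ε) (hxu : ∀ v, lam * x v ≤ ε * u v)
include hμ hlamε hxu

lemma moment_le_pow_mul_prod {F : Finset (ι × κ)} {X : Finset (ι ⊕ κ)} (hXF : X ⊆ verts F)
    (hcard : X.card ≤ F.card) : moment lam x F ≤ ε ^ F.card * ∏ v ∈ X, u v := by
  have hlam := hμ.lam_mem.1
  have hx := fun v => (hμ.prob_mem v).1
  have hε : 0 ≤ ε := hlam.trans hlamε
  calc moment lam x F ≤ lam ^ F.card * ∏ v ∈ X, x v :=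
        mul_le_mul_of_nonneg_left
          (Finset.prod_le_prod_of_subset_of_le_one hXF (fun v _ => hx v)
            fun v _ _ => (hμ.prob_mem v).2) (pow_nonneg hlam _)
    _ = lam ^ (F.card - X.card) * ∏ v ∈ X, lam * x v := by
        rw [Finset.prod_mul_distrib, Finset.prod_const, ← mul_assoc, pow_sub_mul_pow lam hcard]
    _ ≤ ε ^ (F.card - X.card) * ∏ v ∈ X, ε * u v :=
        mul_le_mul (pow_le_pow_left₀ hlam hlamε _)
          (Finset.prod_le_prod (fun v _ => mul_nonneg hlam (hx v)) fun v _ => hxu v)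
          (Finset.prod_nonneg fun v _ => mul_nonneg hlam (hx v)) (pow_nonneg hε _)
    _ = ε ^ F.card * ∏ v ∈ X, u v := by
        rw [Finset.prod_mul_distrib, Finset.prod_const, ← mul_assoc, pow_sub_mul_pow ε hcard]

variable [Fintype ι] [Fintype κ] (hu : IsNodeWeight u)
include hu

lemma moment_mul_schurWeight_le {A B : Finset (ι × κ)} (hAB : EachPartMeets A B)
    (hBA : EachPartMeets B A) :
    moment lam x (symmDiff A B) * schurWeight u B ≤
      ε ^ (symmDiff A B).card * outsideWeight u (verts A) (symmDiff A B) * schurWeight u A :=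
  calc _ ≤ ε ^ (symmDiff A B).card * (∏ v ∈ symmDiff (verts A) (verts B), u v) *
        schurWeight u B :=
        mul_le_mul_of_nonneg_right
          (hμ.moment_le_pow_mul_prod hlamε hxu (symmDiff_verts_subset A B)
            (hAB.card_symmDiff_verts_le hBA)) (hu.schurWeight_pos B).le
    _ = _ := by
        rw [mul_assoc, schurWeight, prod_symmDiff_mul_prod, ← verts_symmDiff_sdiff_verts,
          mul_assoc, mul_comm (outsideWeight _ _ _)]
        rfl

lemma abs_integral_centredPoly_mul_mul_schurWeight_le (A B : Finset (ι × κ)) :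
    |∫ Y, centredPoly lam x A Y * centredPoly lam x B Y ∂μ| * schurWeight u B ≤
      (16 * ε) ^ (symmDiff A B).card * outsideWeight u (verts A) (symmDiff A B) *
        schurWeight u A := by
  have hε : 0 ≤ ε := hμ.lam_mem.1.trans hlamε
  by_cases hmeet : EachPartMeets A B ∧ EachPartMeets B A
  · calc _ ≤ 16 ^ (symmDiff A B).card * moment lam x (symmDiff A B) * schurWeight u B :=
          mul_le_mul_of_nonneg_right (hμ.abs_integral_centredPoly_mul_le A B)
            (hu.schurWeight_pos B).le
      _ ≤ 16 ^ (symmDiff A B).card * (ε ^ (symmDiff A B).card *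
          outsideWeight u (verts A) (symmDiff A B) * schurWeight u A) := by
          rw [mul_assoc]
          exact mul_le_mul_of_nonneg_left
            (hμ.moment_mul_schurWeight_le hlamε hxu hu hmeet.1 hmeet.2) (by positivity)
      _ = _ := by
          rw [mul_pow]
          ring
  · have hzero : ∫ Y, centredPoly lam x A Y * centredPoly lam x B Y ∂μ = 0 := by
      rcases not_and_or.1 hmeet with hAB | hBA
      · exact hμ.integral_centredPoly_mul_eq_zero hAB
      · simpa only [mul_comm] using hμ.integral_centredPoly_mul_eq_zero hBA
    rw [hzero, abs_zero, zero_mul]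
    exact mul_nonneg (mul_nonneg (by positivity) (outsideWeight_nonneg _))
      (hu.schurWeight_pos A).le

variable {D : ℕ} (hD : 1 ≤ D) (hDε : 2048 * (D : ℝ) ^ 2 * ε ≤ 1)
include hD hDε

lemma sum_abs_gram_sub_one_mul_schurWeight_le {A : Finset (ι × κ)} (hA : A.card ≤ D) :
    ∑ B with B.card ≤ D, |∫ Y, centredPoly lam x A Y * centredPoly lam x B Y ∂μ -
      if A = B then 1 else 0| * schurWeight u B ≤ 2048 * (D : ℝ) ^ 2 * ε * schurWeight u A := by
  have hε : 0 ≤ ε := hμ.lam_mem.1.trans hlamε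
  have hA' : A ∈ Finset.univ.filter fun B : Finset (ι × κ) => B.card ≤ D := by simpa using hA
  have hdiag : |∫ Y, centredPoly lam x A Y * centredPoly lam x A Y ∂μ - 1| ≤ (D : ℝ) ^ 2 * ε := by
    have hcard : (A.card : ℝ) ≤ (D : ℝ) ^ 2 := by
      exact_mod_cast hA.trans (Nat.le_self_pow two_ne_zero D)
    exact (hμ.abs_integral_centredPoly_mul_self_sub_one_le A).trans
      (mul_le_mul hcard hlamε hμ.lam_mem.1 (by positivity))
  have hoff := mul_le_mul_of_nonneg_right
    (hu.sum_pow_card_symmDiff_mul_outsideWeight_le hε hD hDε hA) (hu.schurWeight_pos A).le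
  rw [← Finset.add_sum_erase _ _ hA', if_pos rfl]
  calc _ ≤ (D : ℝ) ^ 2 * ε * schurWeight u A + 2047 * (D : ℝ) ^ 2 * ε * schurWeight u A := by
        refine add_le_add (mul_le_mul_of_nonneg_right hdiag (hu.schurWeight_pos A).le)
          (le_trans ?_ hoff)
        rw [Finset.sum_mul]
        refine Finset.sum_le_sum fun B hB => ?_
        rw [if_neg (Finset.ne_of_mem_erase hB).symm, sub_zero]
        exact hμ.abs_integral_centredPoly_mul_mul_schurWeight_le hlamε hxu hu A B
    _ = _ := by ring

lemma abs_integral_sq_sum_centredPoly_sub_le {c : Finset (ι × κ) → ℝ}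
    (hc : ∀ A, D < A.card → c A = 0) :
    |∫ Y, (∑ A, c A * centredPoly lam x A Y) ^ 2 ∂μ - ∑ A, c A ^ 2| ≤
      2048 * (D : ℝ) ^ 2 * ε * ∑ A, c A ^ 2 := by
  set s := Finset.univ.filter fun A : Finset (ι × κ) => A.card ≤ D with hs
  have hcs : ∀ A ∉ s, c A = 0 := fun A hA => hc A (by simpa [hs] using hA)
  have hpoly (Y : ι × κ → ℝ) :
      ∑ A, c A * centredPoly lam x A Y = ∑ A ∈ s, c A * centredPoly lam x A Y :=
    (Finset.sum_subset (Finset.subset_univ s) fun A _ hA => by rw [hcs A hA, zero_mul]).symm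
  have hsq : ∑ A, c A ^ 2 = ∑ A ∈ s, c A ^ 2 :=
    (Finset.sum_subset (Finset.subset_univ s) fun A _ hA => by
      rw [hcs A hA, zero_pow two_ne_zero]).symm
  simp only [hpoly, hsq]
  exact abs_integral_sq_sum_sub_le (fun A _ B _ => hμ.integrable_centredPoly_mul A B)
    (fun A _ => hu.schurWeight_pos A)
    (fun A hA => hμ.sum_abs_gram_sub_one_mul_schurWeight_le hlamε hxu hu hD hDε
      (Finset.mem_filter.1 hA).2) c

end HasBlockMoments

end NearOrthonormality

section Labellings

/-! ### Labelled templates as edge sets -/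

namespace BiGraph

variable (G : BiGraph)

lemma toSimpleGraph_adj {v : Fin (G.r + 1)} {w : Fin G.s} (hvw : (v, w) ∈ G.E) :
    G.toSimpleGraph.Adj (Sum.inl v) (Sum.inr w) := by
  simp [toSimpleGraph, hvw]

lemma exists_edge_of_adj {x y : Fin (G.r + 1) ⊕ Fin G.s} (hxy : G.toSimpleGraph.Adj x y) :
    ∃ e ∈ G.E, (x = Sum.inl e.1 ∧ y = Sum.inr e.2) ∨ (y = Sum.inl e.1 ∧ x = Sum.inr e.2) := by
  rw [toSimpleGraph, SimpleGraph.fromRel_adj] at hxy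
  rcases hxy.2 with ⟨v, w, hx, hy, hvw⟩ | ⟨v, w, hy, hx, hvw⟩
  · exact ⟨_, hvw, Or.inl ⟨hx, hy⟩⟩
  · exact ⟨_, hvw, Or.inr ⟨hy, hx⟩⟩

lemma mem_componentEdges {c : G.toSimpleGraph.ConnectedComponent}
    {e : Fin (G.r + 1) × Fin G.s} :
    e ∈ G.componentEdges c ↔ e ∈ G.E ∧ G.edgeComponent e = c := by
  simp [componentEdges]

lemma mem_components {c : G.toSimpleGraph.ConnectedComponent} :
    c ∈ G.components ↔ ∃ e ∈ G.E, G.edgeComponent e = c := by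
  simp [components]

lemma edgeComponent_eq_of_touch {e f : Fin (G.r + 1) × Fin G.s} (he : e ∈ G.E) (hf : f ∈ G.E)
    (hef : Touch e f) : G.edgeComponent e = G.edgeComponent f := by
  rcases hef with hrow | hcol
  · rw [edgeComponent, hrow, edgeComponent]
  · have hte := (G.toSimpleGraph_adj he).reachable
    rw [hcol] at hte
    exact SimpleGraph.ConnectedComponent.sound
      (hte.trans (G.toSimpleGraph_adj hf).reachable.symm)

lemma mem_of_reachable {U : Set (Fin (G.r + 1) × Fin G.s)}
    (hU : ∀ e ∈ U, e ∈ G.E → ∀ f ∈ G.E, Touch e f → f ∈ U) {e : Fin (G.r + 1) × Fin G.s}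
    (heU : e ∈ U) (he : e ∈ G.E) {x : Fin (G.r + 1) ⊕ Fin G.s}
    (hx : G.toSimpleGraph.Reachable (Sum.inl e.1) x) :
    ∀ f ∈ G.E, x ∈ endpoints f → f ∈ U := by
  rw [SimpleGraph.reachable_iff_reflTransGen] at hx
  induction hx with
  | refl =>
    exact fun f hf hef => hU e heU he f hf (Or.inl (by simpa [endpoints] using hef))
  | tail _ hxy ih =>
    intro f hf hyf
    obtain ⟨a, ha, h⟩ := G.exists_edge_of_adj hxy
    have haU : a ∈ U := ih a ha (by rcases h with h | h <;> simp [endpoints, h])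
    refine hU a haU ha f hf (touch_iff_not_disjoint.2 (Finset.not_disjoint_iff.2 ⟨_, ?_, hyf⟩))
    rcases h with h | h <;> simp [endpoints, h]

lemma componentEdges_mem_connectedParts {c : G.toSimpleGraph.ConnectedComponent}
    (hc : c ∈ G.components) : G.componentEdges c ∈ (connectedParts G.E).parts := by
  obtain ⟨e, he, rfl⟩ := G.mem_components.1 hc
  refine mem_connectedParts_of_minimal (fun f hf => (G.mem_componentEdges.1 hf).1)
    (G.mem_componentEdges.2 ⟨he, rfl⟩) (fun x hx y hy hxy => ?_) fun U hU heU f hf => ?_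
  · obtain ⟨hxE, hxe⟩ := G.mem_componentEdges.1 hx
    exact G.mem_componentEdges.2 ⟨hy, (G.edgeComponent_eq_of_touch hxE hy hxy).symm.trans hxe⟩
  · obtain ⟨hfE, hfe⟩ := G.mem_componentEdges.1 hf
    exact G.mem_of_reachable hU heU he (SimpleGraph.ConnectedComponent.exact hfe).symm f hfE
      (by simp [endpoints])

/-- The pairs of injective labellings of the nodes of `G` by the rows and the columns of an
`n × d` array. -/
abbrev Labelling (n d : ℕ) : Type := (Fin (G.r + 1) ↪ Fin n) × (Fin G.s ↪ Fin d)

variable {n d : ℕ}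

/-- The edge set of the copy of `G` given by a pair of labellings. -/
def copyEdges (φ : G.Labelling n d) : Finset (Fin n × Fin d) :=
  G.E.image (Prod.map φ.1 φ.2)

lemma injective_prodMap (φ : G.Labelling n d) : Function.Injective (Prod.map φ.1 φ.2) :=
  φ.1.injective.prodMap φ.2.injective

lemma card_copyEdges (φ : G.Labelling n d) : (G.copyEdges φ).card = G.E.card :=
  Finset.card_image_of_injective _ (G.injective_prodMap φ)

lemma mem_copyEdges {φ : G.Labelling n d} {v : Fin (G.r + 1)} {w : Fin G.s} :
    (φ.1 v, φ.2 w) ∈ G.copyEdges φ ↔ (v, w) ∈ G.E :=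
  (G.injective_prodMap φ).mem_finset_image (a := (v, w))

lemma connectedParts_copyEdges (φ : G.Labelling n d) :
    (connectedParts (G.copyEdges φ)).parts =
      G.components.image fun c => (G.componentEdges c).image (Prod.map φ.1 φ.2) := by
  have hpart : ∀ c ∈ G.components, (G.componentEdges c).image (Prod.map φ.1 φ.2) ∈
      (connectedParts (G.copyEdges φ)).parts := fun c hc =>
    image_mem_connectedParts φ.1.injective φ.2.injective (G.componentEdges_mem_connectedParts hc)
  refine Finset.Subset.antisymm (fun C hC => ?_) (Finset.image_subset_iff.2 hpart)
  obtain ⟨x, hx⟩ := (connectedParts (G.copyEdges φ)).nonempty_of_mem_parts hC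
  obtain ⟨e, he, rfl⟩ := Finset.mem_image.1 ((connectedParts (G.copyEdges φ)).le hC hx)
  have hc := G.mem_components.2 ⟨e, he, rfl⟩
  have hmem := Finset.mem_image_of_mem (Prod.map φ.1 φ.2) (G.mem_componentEdges.2 ⟨he, rfl⟩)
  exact Finset.mem_image.2
    ⟨_, hc, (connectedParts (G.copyEdges φ)).eq_of_mem_parts (hpart _ hc) hC hmem hx⟩

lemma injOn_componentEdges : Set.InjOn G.componentEdges G.components := by
  intro c hc c' _ hEq
  obtain ⟨e, he, rfl⟩ := G.mem_components.1 hc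
  exact (G.mem_componentEdges.1 (hEq ▸ G.mem_componentEdges.2 ⟨he, rfl⟩)).2

lemma componentMonomial_eq_mono (c : G.toSimpleGraph.ConnectedComponent) (φ : G.Labelling n d) :
    G.componentMonomial c φ.1 φ.2 = mono ((G.componentEdges c).image (Prod.map φ.1 φ.2)) := by
  ext Y
  exact (Finset.prod_image (G.injective_prodMap φ).injOn).symm

lemma labelledPoly_eq_centredPoly {Kn Kd : ℕ} {lam : ℝ} (hlam : lam ∈ Set.Icc (0 : ℝ) 1)
    (hKn : Kn ≤ n) (hKd : Kd ≤ d) (φ : G.Labelling n d) (Y : Fin n × Fin d → ℝ) :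
    G.labelledPoly Kn Kd lam φ.1 φ.2 Y =
      centredPoly lam (selectionProb n d Kn Kd) (G.copyEdges φ) Y := by
  have hinj : Set.InjOn (fun c => (G.componentEdges c).image (Prod.map φ.1 φ.2)) G.components :=
    (Finset.image_injective (G.injective_prodMap φ)).comp_injOn G.injOn_componentEdges
  calc
    _ = ∏ c ∈ G.components, (mono ((G.componentEdges c).image (Prod.map φ.1 φ.2)) Y -
          moment lam (selectionProb n d Kn Kd)
            ((G.componentEdges c).image (Prod.map φ.1 φ.2))) := by
      simp only [labelledPoly, componentMonomial_eq_mono,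
        integral_mono_mixtureLaw hlam hKn hKd]
    _ = ∏ C ∈ (connectedParts (G.copyEdges φ)).parts,
          (mono C Y - moment lam (selectionProb n d Kn Kd) C) := by
      rw [connectedParts_copyEdges, Finset.prod_image hinj]

end BiGraph

/-! ### Counting labellings -/

lemma exists_equiv_of_range_eq {α β γ : Type*} (f : α ↪ γ) (g : β ↪ γ)
    (hfg : Set.range f = Set.range g) : ∃ e : α ≃ β, ∀ a, g (e a) = f a :=
  ⟨(Equiv.ofInjective f f.injective).trans ((Equiv.setCongr hfg).trans
    (Equiv.ofInjective g g.injective).symm),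
    fun _ => Equiv.apply_ofInjective_symm g.injective _⟩

lemma card_embeddings_apply_zero_eq {α : Type*} [Fintype α] [DecidableEq α] (a : α) (r : ℕ) :
    (Finset.univ.filter fun σ : Fin (r + 1) ↪ α => σ 0 = a).card =
      (Fintype.card α - 1).descFactorial r := by
  have hcard : Fintype.card {b : α // b ≠ a} = Fintype.card α - 1 := by
    rw [Fintype.card_subtype_compl, Fintype.card_subtype_eq]
  rw [← hcard]
  conv_rhs => rw [← Fintype.card_fin r]
  rw [← Fintype.card_embedding_eq, ← Fintype.card_subtype]
  refine Fintype.card_congr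
    { toFun := fun σ => ⟨fun v => ⟨σ.1 v.succ, fun h => ?_⟩, fun v w hvw => ?_⟩
      invFun := fun ρ => ⟨⟨Fin.cons a fun v => (ρ v).1, ?_⟩, rfl⟩
      left_inv := fun σ => ?_
      right_inv := fun ρ => ?_ }
  · exact Fin.succ_ne_zero v (σ.1.injective (h.trans σ.2.symm))
  · exact Fin.succ_injective _ (σ.1.injective (Subtype.ext_iff.1 hvw))
  · refine Fin.cons_injective_iff.2 ⟨?_, Subtype.val_injective.comp ρ.injective⟩
    rintro ⟨v, hv⟩
    exact (ρ v).2 hv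
  · ext v
    exact Fin.cases σ.2.symm (fun _ => rfl) v
  · rfl

lemma factorial_div_factorial_eq_descFactorial {k m : ℕ} (hkm : k ≤ m) :
    (m.factorial : ℝ) / ((m - k).factorial : ℝ) = m.descFactorial k := by
  rw [div_eq_iff (by positivity), mul_comm]
  exact_mod_cast (Nat.factorial_mul_descFactorial hkm).symm

namespace BiGraph

variable {G H : BiGraph} {D n d : ℕ}

lemma copyEdges_trans {f : Fin (G.r + 1) ≃ Fin (H.r + 1)} {g : Fin G.s ≃ Fin H.s}
    (hfg : ∀ v w, (v, w) ∈ G.E ↔ (f v, g w) ∈ H.E) (ψ : H.Labelling n d) :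
    G.copyEdges (f.toEmbedding.trans ψ.1, g.toEmbedding.trans ψ.2) = H.copyEdges ψ := by
  have hmap : G.E.map (f.prodCongr g).toEmbedding = H.E := by
    ext ⟨v, w⟩
    rw [Finset.mem_map_equiv]
    simp [hfg]
  rw [copyEdges, copyEdges, ← hmap, Finset.map_eq_image, Finset.image_image]
  rfl

lemma IsTemplate.mem_range_snd (hG : G.IsTemplate D) (φ : G.Labelling n d) (k : Fin d) :
    k ∈ Set.range φ.2 ↔ Sum.inr k ∈ verts (G.copyEdges φ) := by
  constructor
  · rintro ⟨w, rfl⟩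
    obtain ⟨v, hv⟩ := hG.2.2.2 w
    exact inr_mem_verts.2 ⟨φ.1 v, G.mem_copyEdges.2 hv⟩
  · intro hk
    obtain ⟨i, hi⟩ := inr_mem_verts.1 hk
    obtain ⟨e, _, hEq⟩ := Finset.mem_image.1 hi
    exact ⟨e.2, congrArg Prod.snd hEq⟩

lemma normalization_pos (G : BiGraph) (n d : ℕ) : 0 < G.normalization n d := by
  have haut : 0 < G.autCard :=
    have : Nonempty {f : Equiv.Perm (Fin (G.r + 1)) × Equiv.Perm (Fin G.s) //
        f.1 0 = 0 ∧ ∀ v w, (v, w) ∈ G.E ↔ (f.1 v, f.2 w) ∈ G.E} := ⟨⟨(1, 1), by simp⟩⟩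
    Nat.card_pos
  unfold normalization
  positivity

/-- The pairs of labellings that send the distinguished node to the first row. -/
def labellings (G : BiGraph) (n d : ℕ) [NeZero n] : Finset (G.Labelling n d) :=
  (Finset.univ.filter fun σ : Fin (G.r + 1) ↪ Fin n => σ 0 = 0) ×ˢ Finset.univ

variable [NeZero n]

lemma mem_labellings {φ : G.Labelling n d} : φ ∈ G.labellings n d ↔ φ.1 0 = 0 := by
  simp [labellings]

lemma templatePoly_eq_sum {Kn Kd : ℕ} {lam : ℝ} (hlam : lam ∈ Set.Icc (0 : ℝ) 1)
    (hKn : Kn ≤ n) (hKd : Kd ≤ d) (G : BiGraph) (Y : Fin n × Fin d → ℝ) :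
    G.templatePoly Kn Kd lam Y = ∑ φ ∈ G.labellings n d,
      centredPoly lam (selectionProb n d Kn Kd) (G.copyEdges φ) Y := by
  simp only [← G.labelledPoly_eq_centredPoly hlam hKn hKd, labellings, Finset.sum_product,
    templatePoly]

lemma IsTemplate.mem_range_fst (hG : G.IsTemplate D) {φ : G.Labelling n d} (hφ : φ.1 0 = 0)
    (i : Fin n) : i ∈ Set.range φ.1 ↔ i = 0 ∨ Sum.inl i ∈ verts (G.copyEdges φ) := by
  constructor
  · rintro ⟨v, rfl⟩
    refine or_iff_not_imp_left.2 fun hv => ?_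
    obtain ⟨w, hw⟩ := hG.2.2.1 v fun hv0 => hv (hv0 ▸ hφ)
    exact inl_mem_verts.2 ⟨φ.2 w, G.mem_copyEdges.2 hw⟩
  · rintro (rfl | hi)
    · exact ⟨0, hφ⟩
    · obtain ⟨k, hk⟩ := inl_mem_verts.1 hi
      obtain ⟨e, _, hEq⟩ := Finset.mem_image.1 hk
      exact ⟨e.1, congrArg Prod.fst hEq⟩

lemma exists_equiv_of_copyEdges_eq (hG : G.IsTemplate D) (hH : H.IsTemplate D)
    {φ : G.Labelling n d} {ψ : H.Labelling n d} (hφ : φ.1 0 = 0) (hψ : ψ.1 0 = 0)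
    (hEq : G.copyEdges φ = H.copyEdges ψ) :
    ∃ (f : Fin (G.r + 1) ≃ Fin (H.r + 1)) (g : Fin G.s ≃ Fin H.s),
      (f 0 = 0 ∧ ∀ v w, (v, w) ∈ G.E ↔ (f v, g w) ∈ H.E) ∧
        (∀ v, ψ.1 (f v) = φ.1 v) ∧ ∀ w, ψ.2 (g w) = φ.2 w := by
  obtain ⟨f, hf⟩ := exists_equiv_of_range_eq φ.1 ψ.1 (by
    ext i
    rw [hG.mem_range_fst hφ, hH.mem_range_fst hψ, hEq])
  obtain ⟨g, hg⟩ := exists_equiv_of_range_eq φ.2 ψ.2 (by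
    ext k
    rw [hG.mem_range_snd, hH.mem_range_snd, hEq])
  refine ⟨f, g, ⟨ψ.1.injective ?_, fun v w => ?_⟩, hf, hg⟩
  · rw [hf, hφ, hψ]
  · rw [← G.mem_copyEdges (φ := φ), ← H.mem_copyEdges (φ := ψ), hf, hg, hEq]

/-- The number of labellings of `G` whose copy has the edge set `A`. -/
def copyCount (G : BiGraph) (A : Finset (Fin n × Fin d)) : ℕ :=
  ((G.labellings n d).filter fun φ => G.copyEdges φ = A).card

lemma IsTemplate.copyCount_copyEdges (hG : G.IsTemplate D) {φ : G.Labelling n d}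
    (hφ : φ ∈ G.labellings n d) : G.copyCount (G.copyEdges φ) = G.autCard := by
  have hφ0 := mem_labellings.1 hφ
  rw [autCard, copyCount, ← Nat.card_eq_finsetCard]
  symm
  refine Nat.card_eq_of_bijective (fun a => ⟨(a.1.1.toEmbedding.trans φ.1,
    a.1.2.toEmbedding.trans φ.2), Finset.mem_filter.2 ⟨mem_labellings.2 ?_,
      copyEdges_trans a.2.2 φ⟩⟩) ⟨?_, ?_⟩
  · exact (congrArg φ.1 a.2.1).trans hφ0
  · rintro ⟨⟨f, g⟩, hfg⟩ ⟨⟨f', g'⟩, hfg'⟩ hEq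
    simp only [Subtype.mk.injEq, Prod.mk.injEq] at hEq ⊢
    exact ⟨Equiv.ext fun v => φ.1.injective (DFunLike.congr_fun hEq.1 v),
      Equiv.ext fun w => φ.2.injective (DFunLike.congr_fun hEq.2 w)⟩
  · rintro ⟨ψ, hψ⟩
    obtain ⟨hψ0, hψE⟩ := Finset.mem_filter.1 hψ
    obtain ⟨f, g, hfg, hf, hg⟩ :=
      exists_equiv_of_copyEdges_eq hG hG (mem_labellings.1 hψ0) hφ0 hψE
    exact ⟨⟨(f, g), hfg⟩, Subtype.ext
      (Prod.ext (Function.Embedding.ext hf) (Function.Embedding.ext hg))⟩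

lemma card_labellings : (G.labellings n d).card =
    (n - 1).descFactorial G.r * d.descFactorial G.s := by
  rw [labellings, Finset.card_product, card_embeddings_apply_zero_eq, Finset.card_univ,
    Fintype.card_embedding_eq, Fintype.card_fin, Fintype.card_fin, Fintype.card_fin]

lemma normalization_eq (hr : G.r + 1 ≤ n) (hs : G.s ≤ d) :
    G.normalization n d = (G.labellings n d).card * G.autCard := by
  rw [normalization, add_comm G.r 1, ← Nat.sub_sub,
    factorial_div_factorial_eq_descFactorial (by omega),
    factorial_div_factorial_eq_descFactorial hs, card_labellings, Nat.cast_mul]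

lemma IsTemplate.r_le (hG : G.IsTemplate D) : G.r ≤ D := by
  have hsub : Finset.univ.erase (0 : Fin (G.r + 1)) ⊆ G.E.image Prod.fst := fun v hv => by
    obtain ⟨w, hw⟩ := hG.2.2.1 v (Finset.ne_of_mem_erase hv)
    exact Finset.mem_image_of_mem Prod.fst hw
  calc G.r = (Finset.univ.erase (0 : Fin (G.r + 1))).card := by simp
    _ ≤ (G.E.image Prod.fst).card := Finset.card_le_card hsub
    _ ≤ D := Finset.card_image_le.trans hG.2.1

lemma IsTemplate.s_le (hG : G.IsTemplate D) : G.s ≤ D := by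
  have hsub : Finset.univ ⊆ G.E.image Prod.snd := fun w _ => by
    obtain ⟨v, hv⟩ := hG.2.2.2 w
    exact Finset.mem_image_of_mem Prod.snd hv
  calc G.s = (Finset.univ : Finset (Fin G.s)).card := by simp
    _ ≤ (G.E.image Prod.snd).card := Finset.card_le_card hsub
    _ ≤ D := Finset.card_image_le.trans hG.2.1

/-! ### Expansion of template combinations over edge sets -/

/-- The coefficient of the edge set `A` in a linear combination of the templates in `𝒢`. -/
def edgeCoeff (𝒢 : Finset BiGraph) (α₀ : ℝ) (α : BiGraph → ℝ) (A : Finset (Fin n × Fin d)) : ℝ :=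
  (if A = ∅ then α₀ else 0) + ∑ G ∈ 𝒢, α G / √(G.normalization n d) * G.copyCount A

lemma exists_labelling_of_copyCount_ne_zero {A : Finset (Fin n × Fin d)}
    (h : G.copyCount A ≠ 0) : ∃ φ : G.Labelling n d, φ.1 0 = 0 ∧ G.copyEdges φ = A := by
  obtain ⟨φ, hφ⟩ := Finset.card_ne_zero.1 h
  exact ⟨φ, mem_labellings.1 (Finset.mem_filter.1 hφ).1, (Finset.mem_filter.1 hφ).2⟩

lemma card_of_copyCount_ne_zero {A : Finset (Fin n × Fin d)} (h : G.copyCount A ≠ 0) :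
    A.card = G.E.card := by
  obtain ⟨φ, -, rfl⟩ := exists_labelling_of_copyCount_ne_zero h
  exact G.card_copyEdges φ

lemma IsTemplate.copyCount_empty (hG : G.IsTemplate D) :
    G.copyCount (∅ : Finset (Fin n × Fin d)) = 0 := by
  by_contra h
  have hcard := card_of_copyCount_ne_zero h
  rw [Finset.card_empty] at hcard
  exact absurd hG.1 (by omega)

lemma IsTemplate.copyCount_eq_zero_or (hG : G.IsTemplate D) (hH : H.IsTemplate D)
    (hGH : ¬G.Equivalent H) (A : Finset (Fin n × Fin d)) :
    G.copyCount A = 0 ∨ H.copyCount A = 0 := by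
  by_contra! hcon
  obtain ⟨φ, hφ, hφA⟩ := exists_labelling_of_copyCount_ne_zero hcon.1
  obtain ⟨ψ, hψ, hψA⟩ := exists_labelling_of_copyCount_ne_zero hcon.2
  obtain ⟨f, g, hfg, -⟩ := exists_equiv_of_copyEdges_eq hG hH hφ hψ (hφA.trans hψA.symm)
  exact hGH ⟨f, g, hfg⟩

lemma sum_copyCount_mul (G : BiGraph) (F : Finset (Fin n × Fin d) → ℝ) :
    ∑ A, (G.copyCount A : ℝ) * F A = ∑ φ ∈ G.labellings n d, F (G.copyEdges φ) := by
  simp only [copyCount, ← nsmul_eq_mul, ← Finset.sum_const]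
  exact Finset.sum_fiberwise' _ _ _

end BiGraph

end Labellings

section Expansion

lemma sq_sum_of_pairwise_mul_eq_zero {α R : Type*} [Semiring R] {s : Finset α} {f : α → R}
    (hf : (s : Set α).Pairwise fun a b => f a * f b = 0) :
    (∑ a ∈ s, f a) ^ 2 = ∑ a ∈ s, f a ^ 2 := by
  rw [sq, Finset.sum_mul_sum]
  refine Finset.sum_congr rfl fun a ha => ?_
  rw [Finset.sum_eq_single_of_mem a ha fun b hb hba => hf ha hb hba.symm, sq]

namespace BiGraph

variable {D n d : ℕ} [NeZero n] {𝒢 : Finset BiGraph}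

lemma edgeCoeff_eq_zero (h𝒢 : ∀ G ∈ 𝒢, G.IsTemplate D) (α₀ : ℝ) (α : BiGraph → ℝ)
    (A : Finset (Fin n × Fin d)) (hA : D < A.card) : edgeCoeff 𝒢 α₀ α A = 0 := by
  have hA0 : A ≠ ∅ := Finset.card_ne_zero.1 (by omega) |>.ne_empty
  have hcount : ∀ G ∈ 𝒢, G.copyCount A = 0 := fun G hG => by
    by_contra h
    exact hA.not_ge ((card_of_copyCount_ne_zero h).trans_le (h𝒢 G hG).2.1)
  rw [edgeCoeff, if_neg hA0, zero_add]
  exact Finset.sum_eq_zero fun G hG => by rw [hcount G hG, Nat.cast_zero, mul_zero]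

lemma add_sum_Psi_eq {Kn Kd : ℕ} {lam : ℝ} (hlam : lam ∈ Set.Icc (0 : ℝ) 1) (hKn : Kn ≤ n)
    (hKd : Kd ≤ d) (𝒢 : Finset BiGraph) (α₀ : ℝ) (α : BiGraph → ℝ) (Y : Fin n × Fin d → ℝ) :
    α₀ + ∑ G ∈ 𝒢, α G * G.Psi Kn Kd lam Y =
      ∑ A, edgeCoeff 𝒢 α₀ α A * centredPoly lam (selectionProb n d Kn Kd) A Y := by
  simp only [edgeCoeff, add_mul, Finset.sum_add_distrib, ite_mul, zero_mul, Finset.sum_ite_eq',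
    Finset.mem_univ, if_true, Finset.sum_mul, centredPoly_empty, mul_one]
  rw [Finset.sum_comm]
  congr! 2 with G
  simp only [mul_assoc]
  rw [← Finset.mul_sum, G.sum_copyCount_mul, ← templatePoly_eq_sum hlam hKn hKd, Psi]
  ring

lemma edgeCoeff_sq (h𝒢 : ∀ G ∈ 𝒢, G.IsTemplate D)
    (hne : ∀ G ∈ 𝒢, ∀ H ∈ 𝒢, G.Equivalent H → G = H) (α₀ : ℝ) (α : BiGraph → ℝ)
    (A : Finset (Fin n × Fin d)) :
    edgeCoeff 𝒢 α₀ α A ^ 2 = (if A = ∅ then α₀ ^ 2 else 0) +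
      ∑ G ∈ 𝒢, (α G / √(G.normalization n d)) ^ 2 * (G.copyCount A : ℝ) ^ 2 := by
  rcases eq_or_ne A ∅ with rfl | hA
  · have hcount : ∀ G ∈ 𝒢, G.copyCount (∅ : Finset (Fin n × Fin d)) = 0 :=
      fun G hG => (h𝒢 G hG).copyCount_empty
    rw [edgeCoeff, if_pos rfl, if_pos rfl, Finset.sum_eq_zero fun G hG => by simp [hcount G hG],
      Finset.sum_eq_zero fun G hG => by simp [hcount G hG], add_zero, add_zero]
  · rw [edgeCoeff, if_neg hA, if_neg hA, zero_add, zero_add, sq_sum_of_pairwise_mul_eq_zero]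
    · simp only [mul_pow]
    · intro G hG H hH hGH
      rcases (h𝒢 G hG).copyCount_eq_zero_or (h𝒢 H hH) (fun h => hGH (hne G hG H hH h)) A
        with h | h <;> simp [h]

lemma IsTemplate.sum_copyCount_sq {G : BiGraph} (hG : G.IsTemplate D) :
    ∑ A : Finset (Fin n × Fin d), (G.copyCount A : ℝ) ^ 2 =
      (G.labellings n d).card * G.autCard := by
  simp only [sq]
  rw [G.sum_copyCount_mul, Finset.sum_congr rfl fun φ hφ => by
    rw [hG.copyCount_copyEdges hφ], Finset.sum_const, nsmul_eq_mul]

lemma sum_edgeCoeff_sq (h𝒢 : ∀ G ∈ 𝒢, G.IsTemplate D)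
    (hne : ∀ G ∈ 𝒢, ∀ H ∈ 𝒢, G.Equivalent H → G = H) (hn : D < n) (hd : D ≤ d)
    (α₀ : ℝ) (α : BiGraph → ℝ) :
    ∑ A : Finset (Fin n × Fin d), edgeCoeff 𝒢 α₀ α A ^ 2 = α₀ ^ 2 + ∑ G ∈ 𝒢, α G ^ 2 := by
  simp only [edgeCoeff_sq h𝒢 hne, Finset.sum_add_distrib, Finset.sum_ite_eq', Finset.mem_univ,
    if_true]
  rw [Finset.sum_comm]
  congr 1
  refine Finset.sum_congr rfl fun G hG => ?_
  have hr := (h𝒢 G hG).r_le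
  have hs := (h𝒢 G hG).s_le
  have hpos := G.normalization_pos n d
  rw [← Finset.mul_sum, (h𝒢 G hG).sum_copyCount_sq, ← normalization_eq (by omega) (by omega),
    div_pow, Real.sq_sqrt hpos.le, div_mul_cancel₀ _ hpos.ne']

end BiGraph

end Expansion

section NumericalBounds

/-! ### Numerical bounds -/

lemma mul_sq_mul_rpow_le {D : ℕ} (hD : 2 ≤ D) {cs : ℝ} (hcs : 2 ≤ cs) :
    2048 * (D : ℝ) ^ 2 * (D : ℝ) ^ (-(8 * cs)) ≤ (D : ℝ) ^ (-(cs / 4)) := by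
  have hD2 : (2 : ℝ) ≤ D := by exact_mod_cast hD
  have hD0 : (0 : ℝ) < D := by linarith
  have hconst : (2048 : ℝ) ≤ (D : ℝ) ^ 11 := by
    calc (2048 : ℝ) = 2 ^ 11 := by norm_num
      _ ≤ (D : ℝ) ^ 11 := by gcongr
  calc 2048 * (D : ℝ) ^ 2 * (D : ℝ) ^ (-(8 * cs))
      ≤ (D : ℝ) ^ 11 * (D : ℝ) ^ 2 * (D : ℝ) ^ (-(8 * cs)) := by gcongr
    _ = (D : ℝ) ^ ((13 : ℝ) + -(8 * cs)) := by
        rw [Real.rpow_add hD0, ← pow_add, ← Real.rpow_natCast]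
        norm_num
    _ ≤ (D : ℝ) ^ (-(cs / 4)) :=
        Real.rpow_le_rpow_of_exponent_le (by linarith) (by linarith)

lemma mul_div_le_of_mul_div_sqrt_le {lam ε a m : ℝ} (hm : 0 ≤ m) (h : lam * a / √m ≤ ε) :
    lam * (a / m) ≤ ε * (√m)⁻¹ :=
  calc lam * (a / m) = lam * a / √m * (√m)⁻¹ := by
        rw [← div_eq_mul_inv, div_div, Real.mul_self_sqrt hm, mul_div_assoc]
    _ ≤ ε * (√m)⁻¹ := by gcongr

lemma le_of_one_le_of_div_le {a b m ε : ℝ} (hm : 0 < m) (hb : 1 ≤ b) (ha : 0 ≤ a)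
    (haε : a * ε ≤ 1) (h : b / m ≤ ε) : a ≤ m :=
  calc a ≤ a * b := le_mul_of_one_le_right ha hb
    _ ≤ a * (ε * m) := mul_le_mul_of_nonneg_left ((div_le_iff₀ hm).1 h) ha
    _ = a * ε * m := (mul_assoc a ε m).symm
    _ ≤ m := mul_le_of_le_one_left hm.le haε

lemma lt_of_div_le_of_mul_sq_mul_le_one {D K m : ℕ} {ε : ℝ} (hD : 1 ≤ D) (hK : 1 ≤ K)
    (hKm : K ≤ m) (hKε : (K : ℝ) / m ≤ ε) (hDε : 2048 * (D : ℝ) ^ 2 * ε ≤ 1) : D < m := by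
  have hD1 : (1 : ℝ) ≤ D := by exact_mod_cast hD
  have hm : 2048 * (D : ℝ) ^ 2 ≤ m :=
    le_of_one_le_of_div_le (by exact_mod_cast hK.trans hKm) (by exact_mod_cast hK) (by positivity)
      hDε hKε
  have hDm : (D : ℝ) < m := by nlinarith
  exact_mod_cast hDm

lemma isNodeWeight_inv_sqrt {n d : ℕ} (hn : 0 < n) (hd : 0 < d) :
    IsNodeWeight (ι := Fin n) (κ := Fin d)
      (Sum.elim (fun _ => (√(n : ℝ))⁻¹) fun _ => (√(d : ℝ))⁻¹) where
  pos := by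
    rintro (_ | _) <;> simp only [Sum.elim_inl, Sum.elim_inr] <;> positivity
  sum_rows_le := by simp [hn.ne']
  sum_cols_le := by simp [hd.ne']

end NumericalBounds

end SubmatrixLD

end

theorem mainTheorem2_general {n d : ℕ} [NeZero n] {D Kn Kd : ℕ} {lam ε : ℝ} (hD : 1 ≤ D)
    (hn : D < n) (hd : D ≤ d) (hKn : Kn ≤ n) (hKd : Kd ≤ d) (hlam : lam ∈ Set.Icc (0 : ℝ) 1)
    (hlamε : lam ≤ ε) (hrow : lam * Kn / √n ≤ ε) (hcol : lam * Kd / √d ≤ ε)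
    (hDε : 2048 * (D : ℝ) ^ 2 * ε ≤ 1) {𝒢 : Finset SubmatrixLD.BiGraph}
    (h𝒢 : ∀ G ∈ 𝒢, G.IsTemplate D) (hne : ∀ G ∈ 𝒢, ∀ H ∈ 𝒢, G.Equivalent H → G = H)
    (α₀ : ℝ) (α : SubmatrixLD.BiGraph → ℝ) :
    |∫ Y, (α₀ + ∑ G ∈ 𝒢, α G * G.Psi Kn Kd lam Y) ^ 2
        ∂(SubmatrixLD.mixtureLaw n d Kn Kd lam) - (α₀ ^ 2 + ∑ G ∈ 𝒢, α G ^ 2)| ≤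
      2048 * (D : ℝ) ^ 2 * ε * (α₀ ^ 2 + ∑ G ∈ 𝒢, α G ^ 2) := by
  have hnode : ∀ v : Fin n ⊕ Fin d, lam * SubmatrixLD.selectionProb n d Kn Kd v ≤
      ε * Sum.elim (fun _ => (√(n : ℝ))⁻¹) (fun _ => (√(d : ℝ))⁻¹) v := by
    rintro (_ | _)
    · exact SubmatrixLD.mul_div_le_of_mul_div_sqrt_le (Nat.cast_nonneg n) hrow
    · exact SubmatrixLD.mul_div_le_of_mul_div_sqrt_le (Nat.cast_nonneg d) hcol
  simp only [SubmatrixLD.BiGraph.add_sum_Psi_eq hlam hKn hKd]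
  rw [← SubmatrixLD.BiGraph.sum_edgeCoeff_sq h𝒢 hne hn hd]
  exact (SubmatrixLD.hasBlockMoments_mixtureLaw hlam hKn hKd).abs_integral_sq_sum_centredPoly_sub_le
    hlamε hnode (SubmatrixLD.isNodeWeight_inv_sqrt (by omega) (by omega)) hD hDε
    (SubmatrixLD.BiGraph.edgeCoeff_eq_zero h𝒢 α₀ α)

theorem mainTheorem2 :
    ∃ c₀ : ℝ, 0 < c₀ ∧ ∀ cs : ℝ, c₀ ≤ cs →
      ∀ (n d : ℕ) [NeZero n] (D Kn Kd : ℕ) (lam : ℝ),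
        2 ≤ D → 1 ≤ Kn → Kn ≤ n → 1 ≤ Kd → Kd ≤ d → 0 ≤ lam → lam ≤ 1 →
        ((Kn : ℝ) / n) ⊔ ((Kd : ℝ) / d) ⊔ (lam * Kn / Real.sqrt n) ⊔
            (lam * Kd / Real.sqrt d) ⊔ lam ≤ (D : ℝ) ^ (-(8 * cs)) →
        ∀ 𝒢 : Finset SubmatrixLD.BiGraph, SubmatrixLD.BiGraph.IsTemplateCollection D 𝒢 →
        ∀ (α₀ : ℝ) (α : SubmatrixLD.BiGraph → ℝ),
          (1 - (D : ℝ) ^ (-(cs / 4))) * (α₀ ^ 2 + ∑ G ∈ 𝒢, α G ^ 2) ≤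
              ∫ Y, (α₀ + ∑ G ∈ 𝒢, α G * G.Psi Kn Kd lam Y) ^ 2
                ∂(SubmatrixLD.mixtureLaw n d Kn Kd lam) ∧
            ∫ Y, (α₀ + ∑ G ∈ 𝒢, α G * G.Psi Kn Kd lam Y) ^ 2
                ∂(SubmatrixLD.mixtureLaw n d Kn Kd lam) ≤
              (1 + (D : ℝ) ^ (-(cs / 4))) * (α₀ ^ 2 + ∑ G ∈ 𝒢, α G ^ 2) := by
  refine ⟨2, two_pos, fun cs hcs n d _ D Kn Kd lam hD hKn hKnn hKd hKdd hlam0 hlam1 hmax 𝒢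
    h𝒢 α₀ α => ?_⟩
  simp only [sup_le_iff] at hmax
  obtain ⟨⟨⟨⟨hp, hq⟩, hrow⟩, hcol⟩, hlamε⟩ := hmax
  have hD1 : (1 : ℝ) ≤ D := by exact_mod_cast one_le_two.trans hD
  have hbound := SubmatrixLD.mul_sq_mul_rpow_le hD hcs
  have hsmall := hbound.trans (Real.rpow_le_one_of_one_le_of_nonpos hD1 (by linarith))
  have hn := SubmatrixLD.lt_of_div_le_of_mul_sq_mul_le_one (by omega) hKn hKnn hp hsmall
  have hd := SubmatrixLD.lt_of_div_le_of_mul_sq_mul_le_one (by omega) hKd hKdd hq hsmall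
  have hdev := (mainTheorem2_general (one_le_two.trans hD) hn hd.le hKnn hKdd ⟨hlam0, hlam1⟩ hlamε
    hrow hcol hsmall h𝒢.1 h𝒢.2.1 α₀ α).trans (mul_le_mul_of_nonneg_right hbound
      (add_nonneg (sq_nonneg α₀) (Finset.sum_nonneg fun G _ => sq_nonneg (α G))))
  constructor <;> linarith [abs_le.1 hdev]
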